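/- For $n\ge 1$ let $\mathrm{CI}_n$ be the set of symbols $[i\perp j\,|\,K]=[j\perp i\,|\,K]$ with $i\ne j$ in $[n]=\{1,\dots,n\}$ and $K\subseteq[n]\setminus\{i,j\}$, and let $\mathbb{Q}[\mathrm{CI}_n]$ be the polynomial ring with these symbols as unknowns. The semigraphoid ideal $I_{\mathbf{SG}}$ is generated by the binomials $$[i\perp j\,|\,K\cup \ell]\cdot[i\perp \ell\,|\,K]\;-\;[i\perp j\,|\,K]\cdot[i\perp \ell\,|\,K\cup j]$$ for distinct $i,j,\ell\in[n]$ and $K\subseteq[n]\setminus\{i,j,\ell\}$. The toric ideal is $I_{\mathcal A}=\bigl(I_{\mathbf{SG}}:(\prod \mathrm{CI}_n)^\infty\bigr)$, where $\prod\mathrm{CI}_n$ is the product of all unknowns. A Markov basis of $I_{\mathcal A}$ is an inclusion-minimal set of binomials $x^u-x^v$ that generates $I_{\mathcal A}$. **Proposition.** Let $n=4$, so that there are $24$ unknowns. The semigraphoid ideal $I_{\mathbf{SG}}$ is radical. It is the intersection of the toric ideal $I_{\mathcal A}$ with $17$ prime ideals, each generated by a set of unknowns, and the associated primes of $I_{\mathbf{SG}}$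 are exactly these $18$ distinct ideals. The $17$ monomial primes are the following. 1. Two primes of codimension $12$: the one generated by all $[i\perp j\,|\,K]$ with $|K|\in\{0,2\}$, and the one generated by all $[i\perp j\,|\,K]$ with $|K|=1$. 2. Twelve primes of codimension $15$, namely the images under the relabelings of $\{1,2,3,4\}$ by permutations of the ideal generated by the following unknowns $[i\perp j\,|\,K]$, written $ij|K$: $$12|\emptyset,\ 13|\emptyset,\ 14|\emptyset,\ 34|\emptyset,\ 13|2,\ 14|2,\ 34|2,\ 12|3,\ 24|3,\ 12|4,\ 23|4,\ 34|12,\ 24|13,\ 23|14,\ 12|34.$$ 3. Three primes of codimension $16$, namely the images under these relabelings of the ideal generated by $$12|\emptyset,\ 13|\emptyset,\ 24|\emptyset,\ 34|\emptyset,\ 24|1,\ 34|1,\ 13|2,\ 34|2,\ 12|3,\ 24|3,\ 12|4,\ 13|4,\ 34|12,\ 24|13,\ 13|24,\ 12|34.$$ The toric ideal $I_{\mathcal A}$ has codimension $13$ and degree $396$. It has a Markov basis, and every Markov basis of it consists of $49$ binomials: $24$ of degree $2$, $4$ of degree $3$ and $21$ of degree $4$. -/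

import Mathlib

open MvPolynomial

noncomputable section

namespace Semigraphoid

/-- The conditional independence statements `[i ⊥⊥ j | K]` on `{0, …, n - 1}`, equivalently the
two-dimensional faces of the `n`-cube: an unordered pair `{i, j}` of distinct elements (the first
component) together with a set `K` (the second component) that contains neither of them. -/
abbrev CI (n : ℕ) : Type :=
  {p : Finset (Fin n) × Finset (Fin n) // p.1.card = 2 ∧ Disjoint p.1 p.2}

/-- The statement `[i ⊥⊥ j | K]`. By construction `ci i j K = ci j i K`. -/
def ci {n : ℕ} (i j : Fin n) (K : Finset (Fin n)) (h : i ≠ j ∧ i ∉ K ∧ j ∉ K) : CI n :=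
  ⟨({i, j}, K), Finset.card_pair h.1, by simp [h.2.1, h.2.2]⟩

theorem ci_symm {n : ℕ} (i j : Fin n) (K : Finset (Fin n)) (h : i ≠ j ∧ i ∉ K ∧ j ∉ K) :
    ci i j K h = ci j i K ⟨h.1.symm, h.2.2, h.2.1⟩ := by
  apply Subtype.ext
  simp [ci, Finset.pair_comm]

/-- The polynomial ring `ℚ[CI_n]`, with one unknown for each statement. -/
abbrev Poly (n : ℕ) : Type := MvPolynomial (CI n) ℚ

/-- The semigraphoid binomials
`[i ⊥⊥ j | K ∪ l] · [i ⊥⊥ l | K] - [i ⊥⊥ j | K] · [i ⊥⊥ l | K ∪ j]`,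
for distinct `i, j, l` and `K ⊆ {0, …, n - 1} ∖ {i, j, l}`. -/
def semigraphoidBinomials (n : ℕ) : Set (Poly n) :=
  {f | ∃ (i j l : Fin n) (K : Finset (Fin n)) (hij : i ≠ j) (hil : i ≠ l) (hjl : j ≠ l)
      (hi : i ∉ K) (hj : j ∉ K) (hl : l ∉ K),
      f = X (ci i j (insert l K) ⟨hij, by simp [hil, hi], by simp [hjl, hj]⟩)
            * X (ci i l K ⟨hil, hi, hl⟩)
          - X (ci i j K ⟨hij, hi, hj⟩)
            * X (ci i l (insert j K) ⟨hil, by simp [hij, hi], by simp [hjl.symm, hl]⟩)}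

/-- The semigraphoid ideal `I_SG`. -/
def semigraphoidIdeal (n : ℕ) : Ideal (Poly n) := Ideal.span (semigraphoidBinomials n)

/-- The saturation `(I : g^∞)`: all `f` with `g ^ N * f ∈ I` for some `N`. -/
def saturation {R : Type*} [CommRing R] (I : Ideal R) (g : R) : Ideal R where
  carrier := {f | ∃ N : ℕ, g ^ N * f ∈ I}
  zero_mem' := ⟨0, by simp⟩
  add_mem' := by
    rintro a b ⟨N, hN⟩ ⟨M, hM⟩
    refine ⟨N + M, ?_⟩
    have h : g ^ (N + M) * (a + b) = g ^ M * (g ^ N * a) + g ^ N * (g ^ M * b) := by ring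
    rw [h]
    exact I.add_mem (I.mul_mem_left _ hN) (I.mul_mem_left _ hM)
  smul_mem' := by
    rintro c a ⟨N, hN⟩
    refine ⟨N, ?_⟩
    have h : g ^ N * (c • a) = c * (g ^ N * a) := by rw [smul_eq_mul]; ring
    rw [h]
    exact I.mul_mem_left _ hN

/-- The toric ideal `I_A = (I_SG : (∏ CI_n)^∞)`, where `∏ CI_n` is the product of all unknowns. -/
def toricIdeal (n : ℕ) : Ideal (Poly n) :=
  saturation (semigraphoidIdeal n) (∏ c : CI n, X c)

/-- The monomial prime ideal generated by the unknowns in `T`. -/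
def variableIdeal {n : ℕ} (T : Set (CI n)) : Ideal (Poly n) :=
  Ideal.span ((fun c : CI n => (X c : Poly n)) '' T)

/-- A permutation of `{0, …, n - 1}` relabels the statements:
`[i ⊥⊥ j | K]` goes to `[σ i ⊥⊥ σ j | σ K]`. -/
def relabel {n : ℕ} (σ : Equiv.Perm (Fin n)) (c : CI n) : CI n :=
  ⟨(c.1.1.map σ.toEmbedding, c.1.2.map σ.toEmbedding),
    by rw [Finset.card_map]; exact c.2.1, by rw [Finset.disjoint_map]; exact c.2.2⟩

/-- The symmetry class of the monomial prime on `T`: the monomial primes on the images of `T`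
under all relabelings. -/
def symmetryClass {n : ℕ} (T : Set (CI n)) : Set (Ideal (Poly n)) :=
  Set.range fun σ : Equiv.Perm (Fin n) => variableIdeal (relabel σ '' T)

/-- The monomial primes of codimension 12, on the unknowns `[i ⊥⊥ j | K]` with `|K| ∈ {0, 2}`
and on those with `|K| = 1`. -/
def primes12 : Set (Ideal (Poly 4)) :=
  {variableIdeal {c | c.1.2.card = 0 ∨ c.1.2.card = 2}, variableIdeal {c | c.1.2.card = 1}}

/-- The unknowns generating the representative prime of codimension 15. The elements
`1, 2, 3, 4` are written `0, 1, 2, 3`. -/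
def unknowns15 : Set (CI 4) :=
  {ci 0 1 ∅ (by decide), ci 0 2 ∅ (by decide), ci 0 3 ∅ (by decide), ci 2 3 ∅ (by decide),
   ci 0 2 {1} (by decide), ci 0 3 {1} (by decide), ci 2 3 {1} (by decide),
   ci 0 1 {2} (by decide), ci 1 3 {2} (by decide), ci 0 1 {3} (by decide),
   ci 1 2 {3} (by decide), ci 2 3 {0, 1} (by decide), ci 1 3 {0, 2} (by decide),
   ci 1 2 {0, 3} (by decide), ci 0 1 {2, 3} (by decide)}

/-- The unknowns generating the representative prime of codimension 16. -/
def unknowns16 : Set (CI 4) :=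
  {ci 0 1 ∅ (by decide), ci 0 2 ∅ (by decide), ci 1 3 ∅ (by decide), ci 2 3 ∅ (by decide),
   ci 1 3 {0} (by decide), ci 2 3 {0} (by decide), ci 0 2 {1} (by decide),
   ci 2 3 {1} (by decide), ci 0 1 {2} (by decide), ci 1 3 {2} (by decide),
   ci 0 1 {3} (by decide), ci 0 2 {3} (by decide), ci 2 3 {0, 1} (by decide),
   ci 1 3 {0, 2} (by decide), ci 0 2 {1, 3} (by decide), ci 0 1 {2, 3} (by decide)}

def primes15 : Set (Ideal (Poly 4)) := symmetryClass unknowns15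

def primes16 : Set (Ideal (Poly 4)) := symmetryClass unknowns16

/-- The additional monomial primes. -/
def monomialPrimes : Set (Ideal (Poly 4)) := primes12 ∪ primes15 ∪ primes16

/-- The Hilbert function of `ℚ[x] / I` for a homogeneous ideal `I`: the dimension of the image
of the forms of degree `d` in the quotient. -/
def hilbertFunction {τ : Type*} (I : Ideal (MvPolynomial τ ℚ)) (d : ℕ) : ℕ :=
  Module.finrank ℚ
    ((homogeneousSubmodule τ ℚ d).map (Ideal.Quotient.mkₐ ℚ I).toLinearMap)

/-- The homogeneous ideal `I`, whose quotient has positive dimension, has degree `e`: its Hilbert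
function eventually agrees with a nonzero polynomial `p`, and `e` is the leading coefficient of
`p` times the factorial of the degree of `p`. -/
def HasDegree {τ : Type*} (I : Ideal (MvPolynomial τ ℚ)) (e : ℕ) : Prop :=
  ∃ p : Polynomial ℚ, p ≠ 0 ∧
    (∀ᶠ d : ℕ in Filter.atTop, (hilbertFunction I d : ℚ) = p.eval (d : ℚ)) ∧
    p.leadingCoeff * (Nat.factorial p.natDegree : ℚ) = (e : ℚ)

/-- A binomial: a difference `x^u - x^v` of two monomials. -/
def IsBinomial {τ : Type*} (f : MvPolynomial τ ℚ) : Prop :=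
  ∃ u v : τ →₀ ℕ, f = monomial u 1 - monomial v 1

/-- A Markov basis: an inclusion-minimal set of binomials that generates `I`. -/
def IsMarkovBasis {τ : Type*} (I : Ideal (MvPolynomial τ ℚ))
    (G : Set (MvPolynomial τ ℚ)) : Prop :=
  (∀ g ∈ G, IsBinomial g) ∧ Ideal.span G = I ∧ ∀ H, H ⊂ G → Ideal.span H ≠ I

end Semigraphoid

end

open MvPolynomial

noncomputable section

namespace Semigraphoid

/-! The finite content is a set of certificates on 24 unknowns, verified by evaluation; a few
arguments turn them into statements about ideals.

Toric ideal. Let `J` be generated by the 49 binomials of `markov`, and let `toricKernel` be the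
kernel of the monomial map of an 11 × 24 matrix with 0/1 entries. This kernel is prime, contains
`I_SG` and contains no unknown, so it contains `I_A`. Each of the 25 binomials of degree 3 or 4 lies
in `I_SG` after multiplication by some unknown, so `J ≤ I_A`. The circle closes with
`toricKernel_le_moveIdeal`: modulo `J` every monomial reduces to one that is divisible by none of
the squarefree leading monomials in `groebner`, and such standard monomials have distinct images
under the monomial map (`eq_of_degreeMap_eq`). The latter holds because their supports are faces of
a regular triangulation whose 396 facets have linearly independent columns.

Intersection. Each binomial of degree 3 or 4 comes with one of the 17 monomial primes `P` such that
neither of its monomials lies in `P`, while its product with any unknown of `P` lies in `I_SG`. Take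
`f` in `I_A` and in all 17 primes, expand it by Markov binomials, and project onto the monomials
that lie in every prime. The projection fixes `f` and sends each term of the expansion into `I_SG`
(`monomialProj_markov_mem`). Radicality is then immediate, and the associated primes follow because
the 18 primes are pairwise incomparable.

Degree and codimension. The Hilbert function counts standard monomials by their support; faces of
size 11 alone contribute to the leading coefficient 396/10!. For the height, 13 binomials that
generate `I_A` up to unknowns give the upper bound by Krull's theorem, and a chain of kernels of
monomial maps gives the lower bound.

Markov bases. No monomial of a listed binomial is divisible by a monomial of another one. Hence its
two monomials are congruent modulo `I_A` to no other monomial, and every binomial generating set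
contains it up to sign (`poly_mem_of_span_eq`). -/

theorem associatedPrimes_quotient_sInf {R : Type*} [CommRing R] [IsNoetherianRing R]
    {S : Set (Ideal R)} (hfin : S.Finite) (hprime : ∀ P ∈ S, P.IsPrime)
    (hanti : ∀ P ∈ S, ∀ Q ∈ S, P ≤ Q → P = Q) :
    associatedPrimes R (R ⧸ sInf S) = S := by
  classical
  -- The annihilator of the class of `f` is the intersection of the members of `S` that do not
  -- contain `f`. If it is prime, it is one of them; conversely, an `f` in all members except `P`
  -- has annihilator `P`.
  have hcolon : ∀ f r : R, r ∈ (⊥ : Submodule R (R ⧸ sInf S)).colon {Ideal.Quotient.mk _ f} ↔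
      ∀ Q ∈ S, r * f ∈ Q := by
    intro f r
    rw [Submodule.mem_colon_singleton, Submodule.mem_bot, ← Ideal.Quotient.mk_eq_mk,
      ← Submodule.Quotient.mk_smul, Submodule.Quotient.mk_eq_zero, smul_eq_mul, Submodule.mem_sInf]
  ext P
  rw [AssociatedPrimes.mem_iff, isAssociatedPrime_iff]
  constructor
  · rintro ⟨hP, x, hx⟩
    obtain ⟨f, rfl⟩ := Ideal.Quotient.mk_surjective x
    have hle : (hfin.toFinset.filter (fun Q => f ∉ Q)).inf id ≤ P := by
      intro r hr
      rw [hx, hcolon]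
      intro Q hQ
      by_cases hf : f ∈ Q
      · exact Q.mul_mem_left _ hf
      · have : (hfin.toFinset.filter (fun Q => f ∉ Q)).inf id ≤ Q :=
          Finset.inf_le (f := id) (by simp [hQ, hf])
        exact Q.mul_mem_right _ (this hr)
    obtain ⟨Q, hQ, hQP⟩ := hP.inf_le'.1 hle
    simp only [Finset.mem_filter, Set.Finite.mem_toFinset, id] at hQ hQP
    have hPQ : P ≤ Q := by
      intro r hr
      rw [hx, hcolon] at hr
      exact ((hprime Q hQ.1).mem_or_mem (hr Q hQ.1)).resolve_right hQ.2
    rw [le_antisymm hPQ hQP]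
    exact hQ.1
  · intro hP
    have hPp := hprime P hP
    -- Incomparability enters here: a prime above a finite intersection contains one of the
    -- intersected ideals.
    have hnot : ¬ (hfin.toFinset.erase P).inf id ≤ P := by
      intro h
      obtain ⟨Q, hQ, hQP⟩ := hPp.inf_le'.1 h
      simp only [Finset.mem_erase, Set.Finite.mem_toFinset, id] at hQ hQP
      exact hQ.1 (hanti Q hQ.2 P hP hQP)
    obtain ⟨f, hf, hfP⟩ := SetLike.not_le_iff_exists.1 hnot
    refine ⟨hPp, Ideal.Quotient.mk _ f, ?_⟩
    ext r
    rw [hcolon]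
    constructor
    · intro hr Q hQ
      by_cases hQP : Q = P
      · rw [hQP]; exact P.mul_mem_right _ hr
      · have : (hfin.toFinset.erase P).inf id ≤ Q :=
          Finset.inf_le (f := id) (by simp [hQ, hQP])
        exact Q.mul_mem_left _ (this hf)
    · intro h
      exact (hPp.mem_or_mem (h P hP)).resolve_right hfP

/-! ### Monomial primes, binomials and monomial maps -/

section Monomial

variable {σ τ : Type*}

/-- The ideal generated by the variables in `T`. -/
abbrev varIdeal (T : Set σ) : Ideal (MvPolynomial σ ℚ) :=
  Ideal.span ((fun c : σ => (X c : MvPolynomial σ ℚ)) '' T)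

theorem mem_varIdeal {T : Set σ} {f : MvPolynomial σ ℚ} :
    f ∈ varIdeal T ↔ ∀ m ∈ f.support, ∃ i ∈ T, (m : σ →₀ ℕ) i ≠ 0 :=
  mem_ideal_span_X_image

theorem monomial_mem_varIdeal {T : Set σ} {m : σ →₀ ℕ} :
    monomial m (1 : ℚ) ∈ varIdeal T ↔ ∃ i ∈ T, m i ≠ 0 := by
  classical
  rw [mem_varIdeal, support_monomial, if_neg one_ne_zero]
  simp

theorem X_mem_varIdeal {T : Set σ} {c : σ} : (X c : MvPolynomial σ ℚ) ∈ varIdeal T ↔ c ∈ T := by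
  classical
  rw [X, monomial_mem_varIdeal]
  simp [Finsupp.single_apply]

theorem varIdeal_le {S T : Set σ} : varIdeal S ≤ varIdeal T ↔ S ⊆ T := by
  constructor
  · intro h c hc
    exact X_mem_varIdeal.1 (h (X_mem_varIdeal.2 hc))
  · intro h
    exact Ideal.span_mono (Set.image_mono h)

theorem varIdeal_injective : Function.Injective (varIdeal : Set σ → _) := fun _ _ h =>
  Set.Subset.antisymm (varIdeal_le.1 h.le) (varIdeal_le.1 h.ge)

/-- The ideal is the kernel of the endomorphism that sets the variables in `T` to zero, and the
target is a domain. -/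
theorem isPrime_varIdeal (T : Set σ) : (varIdeal T).IsPrime := by
  classical
  let φ : MvPolynomial σ ℚ →ₐ[ℚ] MvPolynomial σ ℚ := aeval fun c => if c ∈ T then 0 else X c
  have hφ : ∀ f, f - φ f ∈ varIdeal T := by
    intro f
    induction f using MvPolynomial.induction_on with
    | C a => simp [φ]
    | add p q hp hq =>
      rw [map_add, add_sub_add_comm]
      exact add_mem hp hq
    | mul_X p i hp =>
      have hX : X i - φ (X i) ∈ varIdeal T := by
        by_cases hi : i ∈ T
        · simpa [φ, hi] using X_mem_varIdeal.2 hi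
        · simp [φ, hi]
      have : p * X i - φ (p * X i) = (p - φ p) * X i + φ p * (X i - φ (X i)) := by
        rw [map_mul]; ring
      rw [this]
      exact add_mem (Ideal.mul_mem_right _ _ hp) (Ideal.mul_mem_left _ _ hX)
  have hker : varIdeal T = RingHom.ker φ := by
    apply le_antisymm
    · rw [Ideal.span_le]
      rintro _ ⟨c, hc, rfl⟩
      simp [φ, hc, RingHom.mem_ker]
    · intro f hf
      have := hφ f
      rwa [RingHom.mem_ker.1 hf, sub_zero] at this
  rw [hker]
  exact RingHom.ker_isPrime φ

/-- Krull's height theorem bounds the height above; adjoining the variables one at a time gives a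
strict chain of primes that bounds it below. -/
theorem height_varIdeal [Finite σ] (T : Set σ) : (varIdeal T).height = T.ncard := by
  apply le_antisymm
  · have hmin : varIdeal T ∈ (varIdeal T).minimalPrimes := by
      have := isPrime_varIdeal T
      rw [Ideal.minimalPrimes_eq_subsingleton_self]
      rfl
    refine (Ideal.height_le_card_of_mem_minimalPrimes_span (Set.toFinite _) hmin).trans ?_
    exact_mod_cast Set.ncard_image_le (Set.toFinite T)
  · induction T, Set.toFinite T using Set.Finite.induction_on with
    | empty => simp
    | @insert a s ha hs ih =>
      have h1 := isPrime_varIdeal s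
      have h2 := isPrime_varIdeal (insert a s)
      have hlt : varIdeal s < varIdeal (insert a s) := by
        refine lt_of_le_not_ge (varIdeal_le.2 (Set.subset_insert _ _)) fun h => ?_
        exact ha (varIdeal_le.1 h (Set.mem_insert _ _))
      rw [Set.ncard_insert_of_notMem ha hs]
      refine le_trans ?_ (Ideal.height_add_one_le_of_lt_of_isPrime hlt)
      push_cast
      gcongr

/-- The binomial `x^u - x^v`. -/
def binom (u v : σ →₀ ℕ) : MvPolynomial σ ℚ := monomial u 1 - monomial v 1

theorem binom_add (c u v : σ →₀ ℕ) :
    binom (c + u) (c + v) = monomial c 1 * binom u v := by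
  simp [binom, mul_sub, monomial_mul]

theorem binom_symm (u v : σ →₀ ℕ) : binom v u = - binom u v := by simp [binom]

theorem binom_trans (u v t : σ →₀ ℕ) : binom u v + binom v t = binom u t := by simp [binom]

/-- The map of exponent vectors with `single c k ↦ k • row c`. -/
def degreeMap (row : σ → τ →₀ ℕ) : (σ →₀ ℕ) →+ (τ →₀ ℕ) :=
  Finsupp.liftAddHom fun c => (multiplesHom (τ →₀ ℕ) (row c))

theorem degreeMap_single (row : σ → τ →₀ ℕ) (c : σ) (k : ℕ) :
    degreeMap row (Finsupp.single c k) = k • row c := by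
  simp [degreeMap]

theorem degreeMap_apply [Fintype σ] (row : σ → τ →₀ ℕ) (u : σ →₀ ℕ) :
    degreeMap row u = ∑ c, u c • row c := by
  simp [degreeMap, Finsupp.sum_fintype]

/-- The monomial map of the polynomial ring with exponents `row`. -/
def toricMap (row : σ → τ →₀ ℕ) : MvPolynomial σ ℚ →ₐ[ℚ] MvPolynomial τ ℚ :=
  aeval fun c => monomial (row c) 1

theorem toricMap_monomial (row : σ → τ →₀ ℕ) (u : σ →₀ ℕ) (r : ℚ) :
    toricMap row (monomial u r) = monomial (degreeMap row u) r := by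
  have h1 : (u.prod fun c k => (monomial (row c) (1 : ℚ)) ^ k) = monomial (degreeMap row u) 1 := by
    induction u using Finsupp.induction_linear with
    | zero => simp
    | add f g hf hg =>
      rw [Finsupp.prod_add_index' (by simp) (by intros; rw [pow_add]), hf, hg, map_add,
        monomial_mul, mul_one]
    | single a b => simp [degreeMap_single, monomial_pow]
  rw [toricMap, aeval_monomial, h1, algebraMap_eq, C_mul_monomial, mul_one]

instance isPrime_ker_toricMap (row : σ → τ →₀ ℕ) : (RingHom.ker (toricMap row)).IsPrime :=
  RingHom.ker_isPrime _

theorem binom_mem_ker_toricMap {row : σ → τ →₀ ℕ} {u v : σ →₀ ℕ} :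
    binom u v ∈ RingHom.ker (toricMap row) ↔ degreeMap row u = degreeMap row v := by
  rw [RingHom.mem_ker, binom, map_sub, toricMap_monomial, toricMap_monomial, sub_eq_zero]
  exact ⟨fun h => monomial_left_injective one_ne_zero h, fun h => by rw [h]⟩

theorem X_notMem_ker_toricMap (row : σ → τ →₀ ℕ) (c : σ) :
    X c ∉ RingHom.ker (toricMap row) := by
  simp [RingHom.mem_ker, toricMap]

open Classical in
/-- The linear projection onto the monomials whose exponents satisfy `p`. -/
def monomialProj (p : (σ →₀ ℕ) → Prop) : MvPolynomial σ ℚ →ₗ[ℚ] MvPolynomial σ ℚ :=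
  (basisMonomials σ ℚ).constr ℚ fun u => if p u then monomial u 1 else 0

open Classical in
theorem monomialProj_monomial (p : (σ →₀ ℕ) → Prop) (u : σ →₀ ℕ) (r : ℚ) :
    monomialProj p (monomial u r) = if p u then monomial u r else 0 := by
  have h1 : monomialProj p (monomial u 1) = if p u then monomial u 1 else 0 := by
    have := (basisMonomials σ ℚ).constr_basis ℚ
      (fun u => if p u then (monomial u 1 : MvPolynomial σ ℚ) else 0) u
    rwa [coe_basisMonomials] at this
  have h2 : (monomial u r : MvPolynomial σ ℚ) = r • monomial u 1 := by simp [smul_monomial]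
  rw [h2, map_smul, h1]
  split_ifs <;> simp

theorem monomialProj_eq_self {p : (σ →₀ ℕ) → Prop} {f : MvPolynomial σ ℚ}
    (h : ∀ u ∈ f.support, p u) : monomialProj p f = f := by
  classical
  conv_lhs => rw [f.as_sum]
  conv_rhs => rw [f.as_sum]
  rw [map_sum]
  refine Finset.sum_congr rfl fun u hu => ?_
  rw [monomialProj_monomial, if_pos (h u hu)]

/-- Monomial multiples of generators span an ideal over `ℚ`, so a linear map can be tested on them.
It is applied to the projection with values in `I_SG`, and to coefficient functionals with `N = ⊥`.
-/
theorem linearMap_mem_of_mem_span {A : Type*} [AddCommGroup A] [Module ℚ A] (N : Submodule ℚ A)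
    (φ : MvPolynomial σ ℚ →ₗ[ℚ] A) {G : Set (MvPolynomial σ ℚ)}
    (h : ∀ g ∈ G, ∀ c, φ (monomial c 1 * g) ∈ N) {f : MvPolynomial σ ℚ}
    (hf : f ∈ Ideal.span G) : φ f ∈ N := by
  -- Quantifying over all multiples lets the span induction pass through ring multiplication, for
  -- which `φ` is not linear.
  suffices H : ∀ q : MvPolynomial σ ℚ, φ (q * f) ∈ N by simpa using H 1
  induction hf using Submodule.span_induction with
  | mem g hg =>
    intro q
    induction q using MvPolynomial.monomial_add_induction_on with
    | C a =>
      rw [show (C a : MvPolynomial σ ℚ) * g = a • (monomial 0 1 * g) by simp [C_mul'], map_smul]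
      exact N.smul_mem a (h g hg 0)
    | monomial_add a b q _ _ ih =>
      rw [add_mul, map_add]
      refine add_mem ?_ ih
      rw [show (monomial a b : MvPolynomial σ ℚ) * g = b • (monomial a 1 * g) by
        rw [← smul_mul_assoc, smul_monomial, smul_eq_mul, mul_one], map_smul]
      exact N.smul_mem b (h g hg a)
  | zero => simp
  | add x y _ _ hx hy =>
    intro q
    rw [mul_add, map_add]
    exact add_mem (hx q) (hy q)
  | smul a x _ hx =>
    intro q
    rw [smul_eq_mul, ← mul_assoc]
    exact hx _

end Monomial

/-! ### Encoding of unknowns, monomials and binomials by numbers and lists -/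

/-- The bit mask of a set of elements. -/
def bitMask (s : Finset (Fin 4)) : ℕ :=
  (if 0 ∈ s then 1 else 0) + (if 1 ∈ s then 2 else 0) + (if 2 ∈ s then 4 else 0) +
    (if 3 ∈ s then 8 else 0)

/-- The position of `[i ⊥⊥ j | K]` in the list of the 24 statements, ordered by `|K|`. -/
def pairIndex (s K : Finset (Fin 4)) : ℕ :=
  [3, 5, 9, 6, 10, 12, 67, 131, 37, 133, 41, 73, 22, 134, 26, 74, 28, 44, 195, 165, 105, 150, 90,
    60].idxOf (bitMask s + 16 * bitMask K)

/-- The position of a statement in the list. -/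
def idx (c : CI 4) : ℕ := pairIndex c.1.1 c.1.2

theorem idx_lt (c : CI 4) : idx c < 24 := by
  revert c; decide +kernel

theorem idx_injective : Function.Injective idx := by
  intro c d; revert c d; decide +kernel

theorem exists_idx {n : ℕ} (hn : n < 24) : ∃ c, idx c = n := by
  revert n; decide +kernel

theorem card_CI_four : Fintype.card (CI 4) = 24 := by decide +kernel

theorem sum_idx {M : Type*} [AddCommMonoid M] (g : ℕ → M) :
    ∑ c : CI 4, g (idx c) = ∑ n ∈ Finset.range 24, g n :=
  Finset.sum_nbij idx (fun c _ => Finset.mem_range.2 (idx_lt c)) (idx_injective.injOn)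
    (fun _ hn => by
      obtain ⟨c, hc⟩ := exists_idx (Finset.mem_range.1 hn)
      exact ⟨c, by simp, hc⟩) (fun _ _ => rfl)

/-- The exponent vector of the product of the unknowns at the listed positions. -/
def expo (l : List ℕ) : CI 4 →₀ ℕ := Finsupp.equivFunOnFinite.symm fun c => l.count (idx c)

theorem expo_apply (l : List ℕ) (c : CI 4) : expo l c = l.count (idx c) := rfl

theorem expo_append (l l' : List ℕ) : expo (l ++ l') = expo l + expo l' := by
  ext c; simp [expo_apply]

theorem expo_nil : expo [] = 0 := by ext c; simp [expo_apply]

theorem expo_cons (n : ℕ) (l : List ℕ) : expo (n :: l) = expo [n] + expo l :=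
  expo_append [n] l

theorem expo_idx (c : CI 4) : expo [idx c] = Finsupp.single c 1 := by
  ext d
  rw [expo_apply, Finsupp.single_apply, List.count_singleton]
  by_cases h : c = d
  · simp [h]
  · have : idx c ≠ idx d := fun h' => h (idx_injective h')
    simp [h, this]

theorem monomial_expo_pair (c d : CI 4) :
    (X c * X d : Poly 4) = monomial (expo [idx c, idx d]) 1 := by
  rw [expo_cons, expo_idx, expo_idx, X, X, monomial_mul, mul_one]

/-- Remove one occurrence of `n`. -/
def removeOne : List ℕ → ℕ → Option (List ℕ)
  | [], _ => none
  | x :: xs, n => if x == n then some xs else (removeOne xs n).map (List.cons x)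

/-- Remove the elements of the second list from the first, with multiplicities. -/
def removeAll : List ℕ → List ℕ → Option (List ℕ)
  | l, [] => some l
  | l, n :: ns => (removeOne l n).bind fun l' => removeAll l' ns

theorem expo_removeOne {l r : List ℕ} {n : ℕ} (h : removeOne l n = some r) :
    expo l = expo [n] + expo r := by
  induction l generalizing r with
  | nil => simp [removeOne] at h
  | cons x xs ih =>
    rw [removeOne] at h
    split_ifs at h with hx
    · have : x = n := by simpa using hx
      rw [expo_cons, this, Option.some.inj h]
    · obtain ⟨r', hr', rfl⟩ := Option.map_eq_some_iff.1 h
      rw [expo_cons, ih hr', expo_cons x r']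
      abel

theorem expo_removeAll {l a r : List ℕ} (h : removeAll l a = some r) :
    expo l = expo a + expo r := by
  induction a generalizing l with
  | nil =>
    rw [removeAll] at h
    rw [Option.some.inj h, expo_nil, zero_add]
  | cons n ns ih =>
    rw [removeAll] at h
    obtain ⟨l', hl', h'⟩ := Option.bind_eq_some_iff.1 h
    rw [expo_removeOne hl', ih h', expo_cons n ns]
    abel

/-- Whether two lists are permutations of each other. -/
def sameList (l l' : List ℕ) : Bool := removeAll l l' == some []

theorem expo_eq_of_sameList {l l' : List ℕ} (h : sameList l l' = true) : expo l = expo l' := by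
  rw [sameList, beq_iff_eq] at h
  rw [expo_removeAll h, expo_nil, add_zero]

/-- A pair of lists, read as the binomial `x^a - x^b`. -/
abbrev Move := List ℕ × List ℕ

/-- The binomial of a move. -/
def Move.poly (m : Move) : Poly 4 := binom (expo m.1) (expo m.2)

/-- The ideal generated by the binomials of a list of moves. -/
def moveIdeal (L : List Move) : Ideal (Poly 4) := Ideal.span {f | ∃ m ∈ L, f = m.poly}

theorem poly_mem_moveIdeal {L : List Move} {m : Move} (h : m ∈ L) : m.poly ∈ moveIdeal L :=
  Ideal.subset_span ⟨m, h, rfl⟩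

theorem moveIdeal_le {L : List Move} {I : Ideal (Poly 4)} (h : ∀ m ∈ L, m.poly ∈ I) :
    moveIdeal L ≤ I := by
  rw [moveIdeal, Ideal.span_le]
  rintro _ ⟨m, hm, rfl⟩
  exact h m hm

/-- Apply a sequence of moves; the step `2 k` is the `k`-th move, and `2 k + 1` its inverse. -/
def walk (L : List Move) : List ℕ → List ℕ → Option (List ℕ)
  | [], l => some l
  | k :: ks, l =>
    match L[k / 2]? with
    | none => none
    | some m =>
      if k % 2 = 0 then (removeAll l m.1).bind fun r => walk L ks (m.2 ++ r)
      else (removeAll l m.2).bind fun r => walk L ks (m.1 ++ r)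

/-- Whether the path of moves leads from `l` to `t`. -/
def connects (L : List Move) (path l t : List ℕ) : Bool :=
  match walk L path l with
  | none => false
  | some l' => sameList l' t

/-- A step replaces the factor `x^a` of the current monomial by `x^b`, which changes it by a
monomial multiple of a generator up to sign; the differences telescope. -/
theorem binom_mem_of_walk {I : Ideal (Poly 4)} {L : List Move} (hL : ∀ m ∈ L, m.poly ∈ I)
    {path l l' : List ℕ} (h : walk L path l = some l') : binom (expo l) (expo l') ∈ I := by
  have step : ∀ {a b r : List ℕ} {l : List ℕ}, binom (expo a) (expo b) ∈ I →
      removeAll l a = some r → binom (expo l) (expo (b ++ r)) ∈ I := by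
    intro a b r l hab hr
    rw [expo_removeAll hr, expo_append, add_comm (expo a), add_comm (expo b), binom_add]
    exact I.mul_mem_left _ hab
  induction path generalizing l with
  | nil =>
    rw [walk] at h
    rw [Option.some.inj h]
    simp [binom]
  | cons k ks ih =>
    rw [walk] at h
    split at h
    · simp at h
    · rename_i m hm
      have hm' := hL m (List.mem_of_getElem? hm)
      split_ifs at h
      · obtain ⟨r, hr, h'⟩ := Option.bind_eq_some_iff.1 h
        rw [← binom_trans _ (expo (m.2 ++ r))]
        exact add_mem (step hm' hr) (ih h')
      · obtain ⟨r, hr, h'⟩ := Option.bind_eq_some_iff.1 h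
        rw [← binom_trans _ (expo (m.1 ++ r))]
        refine add_mem (step ?_ hr) (ih h')
        rw [binom_symm]
        exact neg_mem hm'

theorem binom_mem_of_connects {I : Ideal (Poly 4)} {L : List Move} (hL : ∀ m ∈ L, m.poly ∈ I)
    {path l t : List ℕ} (h : connects L path l t = true) : binom (expo l) (expo t) ∈ I := by
  rw [connects] at h
  split at h
  · simp at h
  · rename_i l' hl'
    rw [← expo_eq_of_sameList h]
    exact binom_mem_of_walk hL hl'

/-- The set of statements of a bit mask. -/
def maskSet (M : ℕ) : Set (CI 4) := {c | M.testBit (idx c)}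

theorem mem_maskSet {M : ℕ} {c : CI 4} : c ∈ maskSet M ↔ M.testBit (idx c) = true := Iff.rfl

theorem expo_hits_maskSet {M : ℕ} {l : List ℕ} (hl : ∀ n ∈ l, n < 24) :
    (∃ c ∈ maskSet M, expo l c ≠ 0) ↔ ∃ n ∈ l, M.testBit n = true := by
  constructor
  · rintro ⟨c, hc, h⟩
    rw [expo_apply] at h
    exact ⟨idx c, List.count_pos_iff.1 (Nat.pos_of_ne_zero h), hc⟩
  · rintro ⟨n, hn, h⟩
    obtain ⟨c, rfl⟩ := exists_idx (hl n hn)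
    exact ⟨c, h, by rw [expo_apply]; exact (List.count_pos_iff.2 hn).ne'⟩

/-- The number of elements of a bit mask below `2 ^ 24`. -/
def maskCard (M : ℕ) : ℕ := ((List.range 24).filter M.testBit).length

theorem card_filter_testBit (M : ℕ) :
    (Finset.univ.filter fun c : CI 4 => M.testBit (idx c) = true).card = maskCard M := by
  rw [Finset.card_filter, sum_idx fun n => if M.testBit n = true then 1 else 0,
    ← Finset.card_filter]
  simp [maskCard, Finset.card_def, Finset.range, Multiset.range]

theorem ncard_maskSet (M : ℕ) : (maskSet M).ncard = maskCard M := by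
  rw [← card_filter_testBit, ← Set.ncard_coe_finset]
  congr 1
  ext c
  simp [maskSet]

theorem testBit_eq_of_maskSet_subset {M N : ℕ} (h : maskSet M ⊆ maskSet N) {n : ℕ} (hn : n < 24)
    (hM : M.testBit n = true) : N.testBit n = true := by
  obtain ⟨c, rfl⟩ := exists_idx hn
  exact h hM

theorem maskSet_injOn {M N : ℕ} (hM : M < 2 ^ 24) (hN : N < 2 ^ 24) (h : maskSet M = maskSet N) :
    M = N := by
  apply Nat.eq_of_testBit_eq
  intro n
  by_cases hn : n < 24
  · obtain ⟨c, rfl⟩ := exists_idx hn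
    rw [Bool.eq_iff_iff]
    exact Set.ext_iff.1 h c
  · rw [Nat.testBit_lt_two_pow (hM.trans_le (Nat.pow_le_pow_right two_pos (not_lt.1 hn))),
      Nat.testBit_lt_two_pow (hN.trans_le (Nat.pow_le_pow_right two_pos (not_lt.1 hn)))]

/-! ### Certificates -/

/-- The semigraphoid binomials. -/
def quads : List Move :=
  [([1, 6], [0, 8]), ([9, 18], [7, 19]), ([2, 7], [0, 10]), ([11, 18], [6, 20]),
   ([2, 9], [1, 11]), ([10, 19], [8, 20]), ([3, 6], [0, 12]), ([13, 18], [7, 21]),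
   ([4, 7], [0, 14]), ([15, 18], [6, 22]), ([4, 13], [3, 15]), ([14, 21], [12, 22]),
   ([3, 8], [1, 12]), ([13, 19], [9, 21]), ([5, 9], [1, 16]), ([17, 19], [8, 23]),
   ([5, 13], [3, 17]), ([16, 21], [12, 23]), ([4, 10], [2, 14]), ([15, 20], [11, 22]),
   ([5, 11], [2, 16]), ([17, 20], [10, 23]), ([5, 15], [4, 17]), ([16, 22], [14, 23])]

/-- The masks of the symmetry class of `unknowns15`. -/
def masks15 : List ℕ :=
  [15904399, 15379287, 15115751, 14281371, 14116523, 12171869, 11508085, 10312441, 7763374,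
   7263606, 6117306, 4021628]

/-- The masks of the symmetry class of `unknowns16`. -/
def masks16 : List ℕ :=
  [13616115, 12008685, 7929630]

/-- The cubic and quartic binomials of the Markov basis. Each comes with the mask of the monomial
prime that avoids both monomials, and for each unknown in that prime with a path of quadratic moves
between the multiples of the two monomials by that unknown. -/
def higher : List (List ℕ × List ℕ × ℕ × List (List ℕ)) :=
  [([6, 9, 10], [7, 8, 11], 16515135, [[5, 8, 0], [0, 5, 8], [8, 0, 5], [12, 5, 8, 25], [36, 8,
     0, 17], [28, 0, 5, 41], [2, 10, 7], [10, 7, 2], [7, 2, 10], [27, 10, 7, 14], [19, 2, 10,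
     38], [43, 7, 2, 30]]),
   ([6, 13, 14], [7, 12, 15], 16515135, [[17, 20, 12], [0, 17, 20, 24], [37, 20, 12, 5], [12,
     17, 20], [20, 12, 17], [32, 12, 17, 45], [14, 22, 19], [26, 22, 19, 2], [7, 14, 22, 39],
     [22, 19, 14], [19, 14, 22], [47, 19, 14, 34]]),
   ([8, 13, 16], [9, 12, 17], 16515135, [[1, 29, 32, 12], [29, 32, 24], [41, 32, 24, 9], [24,
     29, 32], [20, 24, 29, 44], [32, 24, 29], [14, 34, 31, 3], [26, 34, 31], [11, 26, 34, 43],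
     [34, 31, 26], [46, 31, 26, 22], [31, 26, 34]]),
   ([10, 15, 16], [11, 14, 17], 16515135, [[5, 41, 44, 16], [29, 44, 36, 8], [41, 44, 36], [21,
     36, 41, 32], [36, 41, 44], [44, 36, 41], [18, 46, 43, 7], [10, 38, 46, 31], [38, 46, 43],
     [34, 43, 38, 23], [46, 43, 38], [43, 38, 46]]),
   ([0, 5, 19, 22], [1, 4, 18, 23], 262080, [[19, 44, 30, 1], [3, 28, 46, 17], [1, 19, 44, 30],
     [28, 46, 17, 3], [5, 3, 28, 46, 37], [39, 44, 30, 1, 7], [13, 19, 44, 30, 24], [26, 28, 46,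
     17, 15], [17, 3, 28, 46], [44, 30, 1, 19], [46, 17, 3, 28], [30, 1, 19, 44]]),
   ([0, 5, 20, 21], [2, 3, 18, 23], 262080, [[7, 40, 34, 13], [15, 32, 42, 5], [1, 7, 40, 34,
     25], [27, 32, 42, 5, 3], [5, 15, 32, 42], [40, 34, 13, 7], [13, 7, 40, 34], [32, 42, 5,
     15], [17, 15, 32, 42, 36], [38, 40, 34, 13, 19], [34, 13, 7, 40], [42, 5, 15, 32]]),
   ([0, 9, 17, 22], [1, 7, 15, 23], 4021628, [[8, 39, 42, 5], [33, 28, 46, 17, 20], [45, 28,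
     46, 17], [28, 46, 17, 45], [19, 2, 30, 1], [1, 19, 2, 30], [5, 8, 39, 42], [39, 42, 5, 8],
     [13, 19, 2, 30, 24], [17, 45, 28, 46], [46, 17, 45, 28], [2, 30, 1, 19], [30, 1, 19, 2],
     [42, 5, 8, 39], [27, 30, 1, 19, 14]]),
   ([0, 11, 17, 21], [2, 6, 13, 23], 6117306, [[9, 27, 30, 1], [33, 40, 34, 13], [45, 40, 34,
     13, 21], [40, 34, 13, 33], [15, 6, 42, 5], [1, 9, 27, 30], [27, 30, 1, 9], [5, 15, 6, 42],
     [13, 33, 40, 34], [17, 15, 6, 42, 36], [34, 13, 33, 40], [6, 42, 5, 15], [30, 1, 9, 27],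
     [42, 5, 15, 6], [39, 42, 5, 15, 18]]),
   ([0, 13, 16, 20], [3, 7, 11, 23], 7263606, [[29, 32, 42, 5, 8], [41, 32, 42, 5], [20, 38,
     46, 17], [32, 42, 5, 41], [7, 14, 34, 13], [1, 7, 14, 34, 25], [5, 41, 32, 42], [13, 7, 14,
     34], [17, 20, 38, 46], [38, 46, 17, 20], [42, 5, 41, 32], [14, 34, 13, 7], [26, 34, 13, 7,
     2], [34, 13, 7, 14], [46, 17, 20, 38]]),
   ([0, 15, 16, 19], [4, 6, 9, 23], 7763374, [[29, 44, 30, 1], [41, 44, 30, 1, 9], [21, 26, 34,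
     13], [44, 30, 1, 29], [3, 18, 46, 17], [1, 29, 44, 30], [5, 3, 18, 46, 37], [13, 21, 26,
     34], [26, 34, 13, 21], [17, 3, 18, 46], [30, 1, 29, 44], [18, 46, 17, 3], [38, 46, 17, 3,
     6], [34, 13, 21, 26], [46, 17, 3, 18]]),
   ([0, 16, 17, 18], [5, 6, 7, 23], 7929630, [[29, 2, 30, 1], [41, 6, 42, 5], [33, 14, 34, 13],
     [45, 18, 46, 17], [1, 29, 2, 30], [2, 30, 1, 29], [5, 41, 6, 42], [6, 42, 5, 41], [13, 33,
     14, 34], [14, 34, 13, 33], [17, 45, 18, 46], [18, 46, 17, 45], [30, 1, 29, 2], [42, 5, 41,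
     6], [34, 13, 33, 14], [46, 17, 45, 18]]),
   ([1, 4, 20, 21], [2, 3, 19, 22], 262080, [[0, 11, 36, 22, 13], [15, 20, 38, 9, 2], [11, 36,
     22, 25], [27, 20, 38, 9], [36, 22, 25, 11], [9, 27, 20, 38], [25, 11, 36, 22], [20, 38, 9,
     27], [22, 25, 11, 36], [38, 9, 27, 20], [29, 27, 20, 38, 40], [42, 36, 22, 25, 31]]),
   ([1, 10, 15, 21], [2, 8, 13, 22], 10312441, [[5, 15, 18, 0], [21, 36, 22, 25], [36, 22, 25,
     21], [44, 36, 22, 25, 33], [0, 5, 15, 18], [15, 18, 0, 5], [27, 10, 38, 9], [9, 27, 10,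
     38], [25, 21, 36, 22], [22, 25, 21, 36], [29, 27, 10, 38, 40], [18, 0, 5, 15], [10, 38, 9,
     27], [38, 9, 27, 10], [43, 38, 9, 27, 30]]),
   ([1, 13, 14, 20], [3, 9, 10, 22], 11508085, [[17, 20, 38, 9, 4], [37, 20, 38, 9], [20, 38,
     9, 37], [32, 42, 47, 29], [0, 11, 26, 22, 13], [11, 26, 22, 25], [9, 37, 20, 38], [25, 11,
     26, 22], [38, 9, 37, 20], [29, 32, 42, 47], [42, 47, 29, 32], [14, 22, 25, 11, 3], [26, 22,
     25, 11], [22, 25, 11, 26], [47, 29, 32, 42]]),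
   ([1, 14, 15, 19], [4, 8, 9, 22], 12008685, [[17, 3, 18, 0], [37, 10, 38, 9], [21, 26, 22,
     25], [44, 30, 47, 29], [0, 17, 3, 18], [3, 18, 0, 17], [10, 38, 9, 37], [9, 37, 10, 38],
     [25, 21, 26, 22], [26, 22, 25, 21], [29, 44, 30, 47], [30, 47, 29, 44], [18, 0, 17, 3],
     [38, 9, 37, 10], [22, 25, 21, 26], [47, 29, 44, 30]]),
   ([1, 14, 17, 18], [5, 7, 8, 22], 12171869, [[17, 45, 18, 0], [37, 45, 18, 0, 5], [33, 14,
     22, 25], [45, 18, 0, 17], [0, 17, 45, 18], [2, 30, 47, 29], [6, 0, 17, 45, 38], [25, 33,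
     14, 22], [14, 22, 25, 33], [18, 0, 17, 45], [29, 2, 30, 47], [30, 47, 29, 2], [42, 47, 29,
     2, 10], [22, 25, 33, 14], [47, 29, 2, 30]]),
   ([2, 12, 13, 20], [3, 10, 11, 21], 13616115, [[13, 7, 14, 4], [25, 11, 26, 8], [20, 38, 23,
     37], [32, 42, 35, 41], [7, 14, 4, 13], [4, 13, 7, 14], [11, 26, 8, 25], [8, 25, 11, 26],
     [37, 20, 38, 23], [38, 23, 37, 20], [41, 32, 42, 35], [42, 35, 41, 32], [14, 4, 13, 7],
     [26, 8, 25, 11], [23, 37, 20, 38], [35, 41, 32, 42]]),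
   ([2, 12, 15, 19], [4, 8, 11, 21], 14116523, [[13, 21, 26, 8, 0], [25, 21, 26, 8], [21, 26,
     8, 25], [44, 30, 35, 41], [3, 8, 25, 21, 14], [8, 25, 21, 26], [10, 38, 23, 37], [26, 8,
     25, 21], [37, 10, 38, 23], [41, 44, 30, 35], [30, 35, 41, 44], [18, 23, 37, 10, 7], [38,
     23, 37, 10], [23, 37, 10, 38], [35, 41, 44, 30]]),
   ([2, 12, 17, 18], [5, 6, 10, 21], 14281371, [[13, 33, 14, 4], [25, 33, 14, 4, 1], [33, 14,
     4, 13], [45, 18, 23, 37], [4, 13, 33, 14], [2, 4, 13, 33, 26], [6, 42, 35, 41], [14, 4, 13,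
     33], [37, 45, 18, 23], [18, 23, 37, 45], [41, 6, 42, 35], [30, 35, 41, 6, 11], [42, 35, 41,
     6], [23, 37, 45, 18], [35, 41, 6, 42]]),
   ([3, 10, 16, 18], [5, 7, 12, 20], 15379287, [[5, 41, 6, 12], [29, 2, 10, 24], [41, 6, 12,
     5], [36, 41, 6, 12, 17], [12, 5, 41, 6], [24, 29, 2, 10], [2, 10, 24, 29], [6, 12, 5, 41],
     [14, 34, 43, 33], [18, 12, 5, 41, 39], [33, 14, 34, 43], [10, 24, 29, 2], [34, 43, 33, 14],
     [46, 43, 33, 14, 22], [43, 33, 14, 34]]),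
   ([3, 11, 14, 19], [4, 9, 12, 20], 15115751, [[17, 3, 6, 12], [9, 37, 10, 24], [37, 10, 24,
     9], [40, 37, 10, 24, 29], [12, 17, 3, 6], [3, 6, 12, 17], [24, 9, 37, 10], [10, 24, 9, 37],
     [26, 22, 39, 21], [21, 26, 22, 39], [30, 24, 9, 37, 43], [6, 12, 17, 3], [22, 39, 21, 26],
     [39, 21, 26, 22], [47, 39, 21, 26, 34]]),
   ([4, 8, 16, 18], [5, 6, 14, 19], 15904399, [[1, 29, 2, 16], [29, 2, 16, 1], [41, 6, 11, 36],
     [24, 29, 2, 16, 13], [16, 1, 29, 2], [2, 16, 1, 29], [36, 41, 6, 11], [6, 11, 36, 41], [14,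
     16, 1, 29, 27], [18, 46, 31, 45], [45, 18, 46, 31], [11, 36, 41, 6], [34, 31, 45, 18, 23],
     [46, 31, 45, 18], [31, 45, 18, 46]]),
   ([6, 9, 14, 17], [7, 8, 15, 16], 16515135, [[17, 45, 28, 0], [0, 17, 45, 28], [8, 0, 17, 45,
     40], [12, 17, 45, 28, 25], [45, 28, 0, 17], [28, 0, 17, 45], [2, 30, 47, 19], [30, 47, 19,
     2], [7, 2, 30, 47, 39], [22, 19, 2, 30, 35], [19, 2, 30, 47], [47, 19, 2, 30]]),
   ([6, 10, 13, 16], [7, 11, 12, 17], 16515135, [[5, 41, 32, 12], [0, 5, 41, 32, 24], [41, 32,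
     12, 5], [12, 5, 41, 32], [20, 12, 5, 41, 44], [32, 12, 5, 41], [14, 34, 43, 7], [10, 7, 14,
     34, 31], [7, 14, 34, 43], [34, 43, 7, 14], [19, 14, 34, 43, 38], [43, 7, 14, 34]]),
   ([8, 11, 13, 14], [9, 10, 12, 15], 16515135, [[1, 9, 37, 20, 12], [9, 37, 20, 24], [37, 20,
     24, 9], [24, 9, 37, 20], [20, 24, 9, 37], [32, 24, 9, 37, 45], [6, 11, 26, 22, 19], [26,
     22, 39, 11], [11, 26, 22, 39], [22, 39, 11, 26], [39, 11, 26, 22], [31, 26, 22, 39, 42]])]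

/-- A Gröbner basis of the toric ideal for the weights `wt`, leading monomials first, with paths of
Markov moves between the two monomials. -/
def groebner : List (List ℕ × List ℕ × List ℕ) :=
  [([11, 14, 17], [10, 15, 16], [55]), ([11, 13, 14, 19], [9, 12, 15, 20], [26, 22, 39]),
   ([4, 17], [5, 15], [45]), ([11, 14, 21], [12, 15, 20], [22, 39]),
   ([11, 14, 23], [15, 16, 20], [47, 39]), ([11, 18], [6, 20], [6]), ([3, 17], [5, 13], [33]),
   ([2, 14], [4, 10], [37]), ([3, 11, 14, 19], [4, 9, 12, 20], [88]),
   ([11, 22], [15, 20], [39]), ([7, 11, 19], [6, 9, 20], [3, 6]), ([16, 22], [14, 23], [46]),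
   ([2, 9, 22], [1, 15, 20], [8, 39]), ([4, 9, 10, 22], [1, 14, 15, 20], [36, 8, 39]),
   ([4, 10, 16, 18], [5, 6, 14, 20], [36, 41, 6]),
   ([4, 10, 11, 21], [2, 12, 15, 20], [36, 22, 39]), ([3, 7, 11, 23], [0, 13, 16, 20], [65]),
   ([4, 8, 11, 21], [2, 12, 15, 19], [83]), ([0, 11, 14, 19], [4, 6, 9, 20], [17, 3, 6]),
   ([3, 10, 16, 18], [5, 7, 12, 20], [86]), ([3, 9, 10, 22], [1, 13, 14, 20], [75]),
   ([0, 9, 17, 22], [1, 7, 15, 23], [60]), ([4, 8, 23], [5, 15, 19], [31, 45]),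
   ([4, 8, 16, 21], [5, 12, 15, 19], [34, 31, 45]), ([7, 11, 21], [6, 13, 20], [15, 6]),
   ([0, 16, 17, 18], [5, 6, 7, 23], [68]), ([2, 3, 19, 22], [1, 4, 20, 21], [71]),
   ([4, 8, 16, 18], [5, 6, 14, 19], [90]), ([0, 9, 10, 22], [1, 7, 15, 20], [5, 8, 39]),
   ([7, 11, 12, 17], [6, 10, 13, 16], [95]), ([0, 10, 16, 18], [5, 6, 7, 20], [5, 41, 6]),
   ([3, 10, 11, 21], [2, 12, 13, 20], [81]), ([4, 8, 9, 22], [1, 14, 15, 19], [77]),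
   ([9, 18], [7, 19], [2]), ([6, 9, 22], [7, 15, 19], [19, 2]),
   ([8, 11, 13, 14], [9, 10, 12, 15], [96]), ([2, 16, 18], [5, 6, 20], [41, 6]),
   ([2, 3, 18, 23], [0, 5, 20, 21], [59]), ([2, 12, 17, 18], [5, 6, 10, 21], [84]),
   ([10, 23], [17, 20], [43]), ([0, 10, 11, 21], [2, 6, 13, 20], [5, 15, 6]),
   ([12, 22], [14, 21], [23]), ([0, 11, 17, 21], [2, 6, 13, 23], [62]),
   ([10, 19], [8, 20], [10]), ([0, 12, 17], [5, 6, 13], [13, 33]),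
   ([0, 14, 17], [5, 7, 15], [17, 45]), ([3, 8], [1, 12], [24]),
   ([0, 16, 17, 21], [5, 6, 13, 23], [34, 13, 33]), ([1, 16], [5, 9], [29]),
   ([10, 16, 21], [12, 17, 20], [34, 43]), ([4, 6, 9, 23], [0, 15, 16, 19], [67]),
   ([6, 9, 14, 23], [7, 15, 16, 19], [47, 19, 2]), ([6, 9, 14, 17], [7, 8, 15, 16], [92]),
   ([2, 8, 13, 22], [1, 10, 15, 21], [73]), ([12, 23], [16, 21], [35]),
   ([2, 13, 19, 22], [1, 15, 20, 21], [26, 8, 39]), ([17, 19], [8, 23], [30]),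
   ([9, 12, 17], [8, 13, 16], [53]), ([7, 8, 11], [6, 9, 10], [49]),
   ([1, 12, 17], [5, 8, 13], [25, 33]), ([1, 14, 17, 18], [5, 7, 8, 22], [78]),
   ([5, 11], [2, 16], [40]), ([13, 18], [7, 21], [14]), ([1, 4, 18, 23], [0, 5, 19, 22], [57]),
   ([6, 13, 22], [7, 15, 21], [19, 14]), ([1, 4, 6, 23], [0, 5, 15, 19], [0, 31, 45]),
   ([9, 21], [13, 19], [27]), ([4, 13], [3, 15], [20]), ([1, 14, 23], [5, 9, 22], [47, 29]),
   ([0, 13, 14], [3, 7, 15], [17, 20]), ([1, 6, 14, 17], [5, 7, 8, 15], [0, 17, 45]),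
   ([1, 11], [2, 9], [9]), ([4, 7], [0, 14], [16]), ([6, 13, 14], [7, 12, 15], [50]),
   ([5, 9, 10, 22], [1, 14, 17, 20], [28, 46, 43]),
   ([1, 14, 17, 21], [5, 8, 13, 22], [22, 25, 33]), ([2, 7], [0, 10], [4]),
   ([3, 6], [0, 12], [12]), ([0, 8], [1, 6], [1]), ([15, 18], [6, 22], [18]),
   ([1, 3, 7, 15, 23], [0, 5, 9, 13, 22], [61, 33])]

/-- The columns of the design matrix, as bit masks. -/
def cols : List ℕ :=
  [1217, 1346, 1412, 1608, 1680, 1824, 129, 65, 258, 66, 260, 132, 520, 72, 528, 144, 544, 288,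
   1, 2, 4, 8, 16, 32]

/-- The row indices of the nonzero entries of the columns. -/
def rows : List (List ℕ) :=
  [[0, 6, 7, 10], [1, 6, 8, 10], [2, 7, 8, 10], [3, 6, 9, 10], [4, 7, 9, 10], [5, 8, 9, 10],
   [0, 7], [0, 6], [1, 8], [1, 6], [2, 8], [2, 7], [3, 9], [3, 6], [4, 9], [4, 7], [5, 9],
   [5, 8], [0], [1], [2], [3], [4], [5]]

/-- Positive weights of the unknowns. -/
def weights : List ℕ :=
  [164, 165, 166, 166, 168, 164, 82, 82, 84, 85, 82, 90, 82, 82, 85, 82, 87, 92, 58, 49, 41, 47,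
   55, 56]

/-- The facets of the triangulation that the weights induce: the bit mask of the set of unknowns,
and the linear functional that agrees with the weights exactly on that set, as eleven digits in
base 100. -/
def facets : List (ℕ × ℕ) :=
  [(1087039, 3947414545373735414035), (1087095, 3947414543373735414237),
   (1087350, 3947414542373735414337), (1095215, 3945414545393737414035),
   (1095271, 3943414543413739414237), (1095339, 3945414345393937414037),
   (1095395, 3943414343413939414239), (1095526, 3942414542423740414337),
   (1095650, 3942414242424040414340), (1103419, 3947414445373835414036),
   (1103475, 3947414443373835414238), (1103531, 3946414345383936414037),
   (1103587, 3946414343383936414239), (1103730, 3947414442373835414338),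
   (1103842, 3945414242394037414340), (1111722, 3945414245394037414037),
   (1111970, 3942413942424340414340), (1152573, 3650414848373432413732),
   (1152629, 3650414846373432413934), (1152884, 3650414842373432414334),
   (1154589, 3551414949363331413631), (1154645, 3551414947363331413833),
   (1154900, 3551414942363331414333), (1160749, 3648414848393434413732),
   (1160805, 3646414846413436413934), (1160873, 3648414648393634413734),
   (1160929, 3646414646413636413936), (1161060, 3642414842453440414334),
   (1161184, 3642414242454040414340), (1162765, 3549414949383333413631),
   (1162821, 3547414947403335413833), (1162889, 3351414951363331413431),
   (1162945, 3349414949383333413633), (1163076, 3542414942453340414333),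
   (1168953, 3650414748373532413733), (1169009, 3650414746373532413935),
   (1169065, 3649414648383633413734), (1169121, 3649414646383633413936),
   (1169264, 3650414742373532414335), (1169376, 3645414242424037414340),
   (1170969, 3452414950353330413531), (1171025, 3452414948353330413733),
   (1171081, 3352414951353330413431), (1171137, 3352414949353330413633),
   (1171280, 3452414942353330414333), (1177256, 3648414548393734413734),
   (1177504, 3642413942454340414340), (1179272, 3252414952353330413330),
   (1222247, 3933414543513739414237), (1222371, 3933414343513939414239),
   (1222502, 3933414542513740414337), (1222626, 3933414242514040414340),
   (1238946, 3933413042515240414340), (1287781, 3636414846513436413934),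
   (1287905, 3636414646513636413936), (1288036, 3636414842513440414334),
   (1288160, 3636414242514040414340), (1289797, 3536414947513335413833),
   (1289921, 3336414949513333413633), (1290052, 3536414942513340414333),
   (1291620, 3636414836513446414334), (1291744, 3636413636514646414346),
   (1293636, 3536414936513346414333), (1299936, 3636413333514946414349),
   (1304480, 3636413342514940414340), (1308064, 3636413336514946414346),
   (1529312, 3636412424514946414358), (1610303, 4838324536463744414935),
   (1610359, 4640344536443742414937), (1610614, 4541354536433741414937),
   (1618479, 4836324536483746414935), (1618535, 4636344536483746414937),
   (1618603, 4836323436484846414946), (1618659, 4636343636484646414946),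
   (1618790, 4536354536483746414937), (1618914, 4536353636484646414946),
   (1626683, 4838323536464744414945), (1626739, 4640343736444542414945),
   (1626795, 4837323436474845414946), (1626851, 4639343636454643414946),
   (1626994, 4541353836434441414944), (1627106, 4539353636454643414946),
   (1634986, 4836323336484946414946), (1635234, 4536353336484946414946),
   (1675837, 4838294836493444414932), (1675893, 4640314836473442414934),
   (1676148, 4244354836433438414934), (1677853, 4838284936493344414931),
   (1677909, 4640304936473342414933), (1678164, 4145354936423337414933),
   (1684013, 4836294836513446414932), (1684069, 4636314836513446414934),
   (1684137, 4836293436514846414946), (1684193, 4636313636514646414946),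
   (1684324, 4236354836513446414934), (1684448, 4236353636514646414946),
   (1686029, 4836284936513346414931), (1686085, 4636304936513346414933),
   (1686340, 4136354936513346414933), (1692217, 4838293536494744414945),
   (1692273, 4640313736474542414945), (1692329, 4837293436504845414946),
   (1692385, 4639313636484643414946), (1692528, 4244354136434138414941),
   (1692640, 4239353636484643414946), (1694544, 3452354936353330414933),
   (1700520, 4836293336514946414946), (1700768, 4236353336514946414946),
   (3183679, 5135413333374947414047), (3183735, 5135413331374947414249),
   (3183990, 5135413330374947414349), (3191855, 4935413535394747414045),
   (3191911, 4735413735414547414245), (3191979, 4935413335394947414047),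
   (3192035, 4735413535414747414247), (3192166, 4635413835424447414344),
   (3192290, 4635413535424747414347), (3200059, 5135413233375047414048),
   (3200115, 5135413231375047414250), (3200171, 5035413234385047414048),
   (3200227, 5035413232385047414250), (3200370, 5135413230375047414350),
   (3200482, 4935413232395047414350), (3208362, 4935413235395047414047),
   (3208610, 4635413235425047414347), (3318887, 4725413735514547414245),
   (3319011, 4725413535514747414247), (3319142, 4626413835514447414344),
   (3319266, 4626413535514747414347), (3323236, 3735414735513547414335),
   (3323360, 3735413535514747414347), (3325252, 3535414935513347414333),
   (3331552, 3735413232515047414350), (3339680, 3735413235515047414347),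
   (3387748, 3735404835523447414434), (3387872, 3735403535524747414447),
   (3389764, 3635404935523347414433), (3396064, 3735403232525047414450),
   (3404192, 3735403235525047414447), (3413055, 6235412222264947414058),
   (3413111, 6035412422284947414258), (3413366, 6035412421284947414358),
   (3429435, 6135412223275047414058), (3429491, 5935412423295047414258),
   (3429547, 6035412224285047414058), (3429603, 5835412424305047414258),
   (3429746, 5935412422295047414358), (3429858, 5735412424315047414358),
   (3560928, 3735412424515047414358), (3625440, 3735402424525047414458),
   (3706943, 5135324233464047414938), (3706999, 5135344031444247414942),
   (3707254, 5135353930434347414943), (3715119, 4935324435483847414936),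
   (3715175, 4735344435483847414938), (3715243, 4935323335484947414947),
   (3715299, 4735343535484747414947), (3715430, 4635354435483847414938),
   (3715554, 4635353535484747414947), (3723323, 5135323233465047414948),
   (3723379, 5135343231445047414950), (3723435, 5035323234475047414948),
   (3723491, 5035343232455047414950), (3723634, 5135353230435047414950),
   (3723746, 4935353232455047414950), (3731626, 4935323235485047414947),
   (3731874, 4635353235485047414947), (3772477, 5135264833523447414932),
   (3772533, 5135264831523447414934), (3774493, 5135254933523347414931),
   (3774549, 5135254931523347414933), (3780653, 4935284835523447414932),
   (3780709, 4735304835523447414934), (3780777, 4935283335524947414947),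
   (3780833, 4735303535524747414947), (3780964, 4235354835523447414934),
   (3781088, 4235353535524747414947), (3782669, 4935274935523347414931),
   (3782725, 4735294935523347414933), (3782980, 4135354935523347414933),
   (3788857, 5135263233525047414948), (3788913, 5135263231525047414950),
   (3788969, 5035273234525047414948), (3789025, 5035273232525047414950),
   (3789280, 4235353232525047414950), (3797160, 4935283235525047414947),
   (3797408, 4235353235525047414947), (3936319, 7135322213264047414958),
   (3936375, 6735342415284247414958), (3936630, 6635352415284347414958),
   (3952699, 6135322223365047414958), (3952755, 5935342423365047414958),
   (3952811, 6035322224375047414958), (3952867, 5835342424375047414958),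
   (3953010, 5935352422355047414958), (3953122, 5735352424375047414958),
   (4018233, 6135162223525047414958), (4018289, 5935182423525047414958),
   (4018345, 6035172224525047414958), (4018401, 5835192424525047414958),
   (4018656, 4235352424525047414958), (5432226, 4230382739545543414643),
   (5432738, 4230412739515543414343), (5433218, 3930412742515540414340),
   (5808811, 5529252736555546414946), (5816891, 5630242736545544414945),
   (5817003, 5530252736545545414946), (5825194, 5430262736545546414946),
   (5825442, 4530352736545546414946), (7373887, 5729412733375547413447),
   (7373943, 5729412725375547414255), (7374198, 5729412724375547414355),
   (7382063, 5727412735395547413245), (7382187, 5529412735395547413447),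
   (7390267, 5630412733375547413548), (7390323, 5630412726375547414255),
   (7390379, 5530412734385547413548), (7390435, 5530412727385547414255),
   (7390578, 5630412725375547414355), (7390690, 5430412727395547414355),
   (7398570, 5430412735395547413547), (7398818, 4630412735475547414347),
   (7504999, 5715412725515547414255), (7505123, 5517412727515547414255),
   (7505254, 5715412724515547414355), (7505378, 5418412727515547414355),
   (7513127, 5715412735515547413245), (7513251, 5517412735515547413447),
   (7513506, 4626412735515547414347), (7521760, 4230412727515547414355),
   (7529888, 4230412735515547414347), (7603263, 6829411622265547413458),
   (7603319, 6029412422345547414258), (7603574, 6029412421345547414358),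
   (7619643, 6630411723275547413558), (7619699, 5930412423345547414258),
   (7619755, 6530411724285547413558), (7619811, 5830412424355547414258),
   (7619954, 5930412422345547414358), (7620066, 5730412424365547414358),
   (7734375, 6012412422515547414258), (7734499, 5814412424515547414258),
   (7734630, 6012412421515547414358), (7734754, 5715412424515547414358),
   (7751136, 4230412424515547414358), (7897207, 6422342718445547414955),
   (7897462, 6323352718435547414955), (7905451, 5529262735545547414947),
   (7913531, 5630272733515547414948), (7913587, 5630342726445547414955),
   (7913643, 5530272734525547414948), (7913699, 5530342727455547414955),
   (7913842, 5630352725435547414955), (7913954, 5430352727455547414955),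
   (7921834, 5430272735535547414947), (7922082, 4630352735535547414947),
   (8126583, 6722342415415547414958), (8126838, 6623352415405547414958),
   (8142907, 6630271723415547414958), (8142963, 5930342423415547414958),
   (8143019, 6530271724425547414958), (8143075, 5830342424425547414958),
   (8143218, 5930352422405547414958), (8143330, 5730352424425547414958),
   (9609831, 4428364538563744414737), (9609955, 4428363838564444414744),
   (9610086, 4428364537563745414837), (9610210, 4428363737564545414845),
   (9675365, 4131364841563441414434), (9675489, 4131364141564141414441),
   (9675620, 4131364837563445414834), (9675744, 4131363737564545414845),
   (9677381, 4031364942563340414333), (9677505, 3331364949563333413633),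
   (9677636, 4031364937563345414833), (9692064, 4131362837565445414845),
   (9994815, 5828224536563744414925), (10002991, 5628244536563746414927),
   (10003047, 4628344536563746414937), (10003171, 4628343636564646414946),
   (10003302, 4528354536563746414937), (10003426, 4528353636564646414946),
   (10060349, 5531224836563444414925), (10062365, 5531214936563344414924),
   (10068525, 5331244836563446414927), (10068581, 4631314836563446414934),
   (10068649, 5331242936565346414946), (10068705, 4631313636564646414946),
   (10068836, 4231354836563446414934), (10068960, 4231353636564646414946),
   (10070541, 5331234936563346414926), (10070597, 4631304936563346414933),
   (10070852, 4131354936563346414933), (10076729, 5531222836565444414945),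
   (10076841, 5431232836565445414946), (10085032, 5331242836565446414946),
   (10085280, 4231352836565446414946), (11706471, 4725364235564047414740),
   (11706595, 4725363535564747414747), (11706726, 4626364335563947414839),
   (11706850, 4626363535564747414847), (11772260, 4131364835563447414834),
   (11772384, 4131363535564747414847), (11774276, 4031364935563347414833),
   (11780576, 4131362828565447414854), (11788704, 4131362835565447414847),
   (12009952, 4131362424565447414858), (12091455, 6125224233564047414928),
   (12099631, 5727244435563847414928), (12099687, 4727344435563847414938),
   (12099811, 4727343535564747414947), (12099942, 4627354435563847414938),
   (12100066, 4627353535564747414947), (12156989, 5531224833563447414928),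
   (12157045, 5531224827563447414934), (12159005, 5531214933563347414927),
   (12159061, 5531214927563347414933), (12165165, 5331244835563447414928),
   (12165221, 4731304835563447414934), (12165289, 5331242935565347414947),
   (12165345, 4731303535564747414947), (12165476, 4231354835563447414934),
   (12165600, 4231353535564747414947), (12167181, 5331234935563347414927),
   (12167237, 4731294935563347414933), (12167492, 4131354935563347414933),
   (12173369, 5531222833565447414948), (12173425, 5531222827565447414954),
   (12173481, 5431232834565447414948), (12173537, 5431232828565447414954),
   (12173792, 4231352828565447414954), (12181672, 5331242835565447414947),
   (12181920, 4231352835565447414947), (12402745, 6531121823565447414958),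
   (12402801, 5931182423565447414958), (12402857, 6431131824565447414958),
   (12402913, 5831192424565447414958), (12403168, 4231352424565447414958),
   (13804450, 4428362737565545414845), (13820832, 4230362737565545414845),
   (14164651, 5628242636565546414946), (14189115, 5828222736565544414943),
   (14197291, 5628242736565546414945), (14197411, 5528252736565546414946),
   (14197417, 5529242736565546414946), (14197666, 4528352736565546414946),
   (14205497, 5630222736565544414945), (14205609, 5530232736565545414946),
   (14213800, 5430242736565546414946), (14214048, 4330352736565546414946),
   (15761471, 7610222733565547413428), (15769647, 7410242735565547413228),
   (15892583, 6210362720565547414755), (15892707, 5517362727565547414755),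
   (15892838, 6210362719565547414855), (15892962, 5418362727565547414855),
   (15900711, 6210362735565547413240), (15900835, 5517362735565547413947),
   (15901090, 4626362735565547414847), (15909344, 4230362727565547414855),
   (15917472, 4230362735565547414847), (16121959, 6507362417565547414758),
   (16122083, 5814362424565547414758), (16122214, 6507362416565547414858),
   (16122338, 5715362424565547414858), (16138720, 4230362424565547414858),
   (16261291, 5727242535565547414947), (16285751, 7610222718565547414943),
   (16285755, 6125222733565547414943), (16285799, 6410342718565547414955),
   (16285813, 7610222706565547414955), (16285923, 5519342727565547414955),
   (16286054, 6310352718565547414955), (16286178, 5419352727565547414955),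
   (16293931, 5727242735565547414945), (16294051, 5527262735565547414947),
   (16294057, 5529242735565547414947), (16294306, 4627352735565547414947),
   (16302137, 5630222733565547414948), (16302193, 5630222726565547414955),
   (16302249, 5530232734565547414948), (16302305, 5530232727565547414955),
   (16302560, 4330352727565547414955), (16310440, 5430242735565547414947),
   (16310688, 4330352735565547414947), (16515175, 6707342415565547414958),
   (16515189, 8207192400565547414958), (16515243, 7916130324565547414958),
   (16515299, 5816342424565547414958), (16515430, 6607352415565547414958),
   (16515554, 5716352424565547414958), (16531513, 6630121723565547414958),
   (16531569, 5930192423565547414958), (16531625, 6530131724565547414958),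
   (16531681, 5830202424565547414958), (16531936, 4330352424565547414958)]

/-- Binomials of the toric ideal, each with an unknown that occurs in one of its monomials; no
binomial contains the unknown of a later entry. -/
def chain : List (ℕ × Move) :=
  [(16, ([10, 15, 16], [11, 14, 17])), (9, ([8, 13, 16], [9, 12, 17])),
   (7, ([6, 9, 10], [7, 8, 11])), (20, ([10, 19], [8, 20])), (0, ([2, 7], [0, 10])),
   (18, ([9, 18], [7, 19])), (21, ([13, 18], [7, 21])), (4, ([4, 10], [2, 14])),
   (22, ([15, 18], [6, 22])), (5, ([5, 15], [4, 17])), (1, ([2, 9], [1, 11])),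
   (23, ([17, 19], [8, 23])), (3, ([3, 6], [0, 12]))]

/-- Semigraphoid binomials that generate the toric ideal up to monomials. -/
def latticeBasis : List Move :=
  [([5, 15], [4, 17]), ([13, 19], [9, 21]), ([15, 18], [6, 22]), ([17, 20], [10, 23]),
   ([4, 10], [2, 14]), ([4, 13], [3, 15]), ([2, 9], [1, 11]), ([3, 8], [1, 12]),
   ([3, 6], [0, 12]), ([11, 18], [6, 20]), ([16, 22], [14, 23]), ([10, 19], [8, 20]),
   ([2, 7], [0, 10])]

/-- The other semigraphoid binomials, each with an unknown and a path that connects the multiples of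
its monomials by the preceding binomials. -/
def latticeRest : List (Move × ℕ × List ℕ) :=
  [(([1, 6], [0, 8]), 3, [16, 15]), (([9, 18], [7, 19]), 2, [14, 20, 0, 25, 27]),
   (([13, 18], [7, 21]), 9, [0, 6]), (([4, 7], [0, 14]), 2, [30, 14]),
   (([14, 21], [12, 22]), 0, [1, 3, 18, 12, 24]), (([17, 19], [8, 23]), 10, [32, 16]),
   (([5, 13], [3, 17]), 4, [22, 12]), (([16, 21], [12, 23]), 14, [4, 34]),
   (([5, 9], [1, 16]), 21, [19, 2, 4, 30, 1]), (([15, 20], [11, 22]), 6, [37, 22]),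
   (([5, 11], [2, 16]), 1, [33, 2])]

/-- The binomials of the Markov basis. -/
def markov : List Move := quads ++ higher.map fun h => (h.1, h.2.1)

/-- The masks of the 17 monomial primes. -/
def primeMasks : List ℕ := [16515135, 262080] ++ masks15 ++ masks16

/-! ### Checkers for the certificates -/

/-- The column of the design matrix of the unknown at a position. -/
def col (n : ℕ) : ℕ := cols.getD n 0

/-- The weight of the unknown at a position. -/
def wt (n : ℕ) : ℕ := weights.getD n 0

/-- The coefficients of a linear functional given by its base 100 digits. -/
def digit (D r : ℕ) : ℕ := D / 100 ^ r % 100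

/-- The value of a linear functional at the column of a position. -/
def value (D n : ℕ) : ℕ :=
  ((rows.getD n []).map (digit D)).sum

/-- Whether two monomials have the same multidegree. -/
def sameDegree (a b : List ℕ) : Bool :=
  (List.range 11).all fun r =>
    (a.countP fun n => (col n).testBit r) == (b.countP fun n => (col n).testBit r)

/-- Gaussian elimination over `ZMod 2` on bit masks; true only for independent lists. -/
def independent : ℕ → List ℕ → Bool
  | _, [] => true
  | 0, _ :: _ => false
  | n + 1, v :: vs => v != 0 &&
      independent n (vs.map fun x => if x.testBit v.log2 then x ^^^ v else x)

/-- Branch on the first element of a list that is missing from a set: `E` is a mask of elements of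
the set, and `C` is a mask of elements outside the set. -/
def branch (k : ℕ → ℕ → Bool) (C : ℕ) : List ℕ → ℕ → Bool
  | [], _ => true
  | b :: bs, E => (E.testBit b || k (C ||| 1 <<< b) E) && branch k C bs (E ||| 1 <<< b)

/-- Whether every set that contains none of the listed sets, contains `E` and is disjoint from `C`
lies in one of the sets of `fs`. -/
def covered (fs : List ℕ) : List (List ℕ) → ℕ → ℕ → Bool
  | [], C, _ => fs.any fun F => (F ||| C).beq 16777215
  | N :: Ns, C, E =>
    if N.any C.testBit then covered fs Ns C E else branch (covered fs Ns) C N E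

/-- Whether each binomial, multiplied by its unknown, follows from the preceding ones. -/
def derivable : List Move → List (Move × ℕ × List ℕ) → Bool
  | _, [] => true
  | L, (m, i, p) :: rest =>
    i < 24 && connects L p (i :: m.1) (i :: m.2) && derivable (m :: L) rest

/-- Whether each binomial is in the toric ideal, contains its unknown on one side, and avoids the
unknowns of the later entries. -/
def triangular : List (ℕ × Move) → Bool
  | [] => true
  | (c, m) :: rest => c < 24 && sameDegree m.1 m.2 && m.1.count c != m.2.count c &&
      (m.1 ++ m.2).all (fun n => n < 24 && !(rest.map Prod.fst).contains n) && triangular rest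

/-! ### Evaluation of the certificates -/

theorem quads_sound : ∀ (i j l : Fin 4) (K : Finset (Fin 4)), i ≠ j → i ≠ l → j ≠ l → i ∉ K →
    j ∉ K → l ∉ K → ∃ q ∈ quads,
      (sameList q.1 [pairIndex {i, j} (insert l K), pairIndex {i, l} K] ∧
        sameList q.2 [pairIndex {i, j} K, pairIndex {i, l} (insert j K)]) ∨
      (sameList q.2 [pairIndex {i, j} (insert l K), pairIndex {i, l} K] ∧
        sameList q.1 [pairIndex {i, j} K, pairIndex {i, l} (insert j K)]) := by
  decide +kernel

theorem quads_complete : ∀ q ∈ quads, ∃ (i j l : Fin 4) (K : Finset (Fin 4)), i ≠ j ∧ i ≠ l ∧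
    j ≠ l ∧ i ∉ K ∧ j ∉ K ∧ l ∉ K ∧
      sameList q.1 [pairIndex {i, j} (insert l K), pairIndex {i, l} K] ∧
        sameList q.2 [pairIndex {i, j} K, pairIndex {i, l} (insert j K)] := by
  decide +kernel

theorem higher_check : ∀ h ∈ higher,
    (∀ n ∈ h.1, h.2.2.1.testBit n = false) ∧ (∀ n ∈ h.2.1, h.2.2.1.testBit n = false) ∧
      h.2.2.1 ∈ primeMasks ∧
      List.Forall₂ (fun i p => connects quads p (i :: h.1) (i :: h.2.1))
        ((List.range 24).filter h.2.2.1.testBit) h.2.2.2 := by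
  decide +kernel

/-- This puts `I_SG` inside each monomial prime, and also shows that each mask contains an unknown.
-/
theorem quads_hit : ∀ q ∈ quads, ∀ M ∈ primeMasks,
    (∃ n ∈ q.1, M.testBit n = true) ∧ ∃ n ∈ q.2, M.testBit n = true := by
  decide +kernel

/-- With `higher_check`, this yields for each monomial prime a Markov binomial outside it, so no
monomial prime contains the toric ideal. -/
theorem primeMasks_avoided : ∀ M ∈ primeMasks, ∃ h ∈ higher, h.2.2.1 = M := by
  decide +kernel

theorem primeMasks_antichain : ∀ M ∈ primeMasks, ∀ N ∈ primeMasks, M = N ∨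
    ∃ n ∈ List.range 24, M.testBit n = true ∧ N.testBit n = false := by
  decide +kernel

theorem masks_check : primeMasks.Nodup ∧ (∀ M ∈ primeMasks, M < 2 ^ 24) ∧
    (∀ M ∈ [16515135, 262080], maskCard M = 12) ∧ (∀ M ∈ masks15, maskCard M = 15) ∧
    ∀ M ∈ masks16, maskCard M = 16 := by
  decide +kernel

theorem markov_check : ∀ m ∈ markov, (∀ n ∈ m.1, n < 24) ∧ (∀ n ∈ m.2, n < 24) ∧
    m.1.length = m.2.length ∧ sameDegree m.1 m.2 = true := by
  decide +kernel

theorem markov_lengths : markov.length = 49 ∧ (markov.countP fun m => m.1.length == 2) = 24 ∧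
    (markov.countP fun m => m.1.length == 3) = 4 ∧
    (markov.countP fun m => m.1.length == 4) = 21 := by
  decide +kernel

theorem markov_nodup : markov.Nodup := by decide +kernel

/-- Failure of `removeAll` means that one monomial does not divide the other. This makes every
Markov binomial unavoidable in a binomial generating set. -/
theorem markov_indispensable : ∀ m ∈ markov, ∀ m' ∈ markov, m = m' ∨
    (removeAll m.1 m'.1 = none ∧ removeAll m.1 m'.2 = none ∧ removeAll m.2 m'.1 = none ∧
      removeAll m.2 m'.2 = none) := by
  decide +kernel

theorem markov_coprime : ∀ m ∈ markov, m.1 ≠ [] ∧ ∀ n ∈ m.1, n ∉ m.2 := by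
  decide +kernel

theorem groebner_check : ∀ g ∈ groebner, g.1.Nodup ∧ (∀ n ∈ g.1, n < 24) ∧
    (g.2.1.map wt).sum < (g.1.map wt).sum ∧ g.1.length = g.2.1.length ∧ (∀ n ∈ g.2.1, n < 24) ∧
    sameDegree g.1 g.2.1 = true ∧ connects markov g.2.2 g.1 g.2.1 = true := by
  decide +kernel

theorem col_lt : ∀ n ∈ List.range 24, col n < 2 ^ 11 := by
  decide +kernel

theorem facets_sorted : (facets.map Prod.fst).Pairwise (· < ·) ∧
    ∀ F ∈ facets.map Prod.fst, F < 2 ^ 24 ∧ maskCard F = 11 := by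
  -- By transitivity it suffices to compare neighbours.
  rw [← List.isChain_iff_pairwise]
  decide +kernel

theorem facets_length : facets.length = 396 := by decide +kernel

theorem rows_check : ∀ n ∈ List.range 24,
    rows.getD n [] = (List.range 11).filter (col n).testBit := by
  decide +kernel

/-- No facet contains a leading monomial; `facets_cover` is the other half, that every set without
leading monomials lies in a facet. -/
theorem facets_standard : (facets.all fun F => groebner.all fun g =>
    g.1.any fun n => !F.1.testBit n) = true := by
  decide +kernel

/-- The lower hull condition for a regular triangulation: the functional lies below the weights and
touches them exactly on the facet. -/
theorem facets_supporting : (facets.all fun F => (List.range 24).all fun n =>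
    if F.1.testBit n then (value F.2 n).beq (wt n) else (value F.2 n + 1).ble (wt n)) = true := by
  decide +kernel

theorem facets_independent : ∀ F ∈ facets,
    independent 11 (((List.range 24).filter F.1.testBit).map col) = true := by
  decide +kernel

theorem facets_cover : covered (facets.map Prod.fst) (groebner.map Prod.fst) 0 0 = true := by
  decide +kernel

theorem latticeRest_check : ∀ q ∈ quads, q ∈ latticeBasis ∨ ∃ r ∈ latticeRest, r.1 = q := by
  decide +kernel

theorem latticeBasis_check : (∀ q ∈ latticeBasis, q ∈ quads) ∧ latticeBasis.length = 13 ∧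
    derivable latticeBasis latticeRest = true := by
  decide +kernel

theorem chain_check : triangular chain = true ∧ chain.length = 13 := by
  decide +kernel

/-! ### Generators of the semigraphoid ideal -/

theorem idx_ci (i j : Fin 4) (K : Finset (Fin 4)) (h : i ≠ j ∧ i ∉ K ∧ j ∉ K) :
    idx (ci i j K h) = pairIndex {i, j} K := rfl

/-- Exchanging `j` and `l` negates a semigraphoid binomial, so `quads` keeps one binomial for each
pair of opposite signs. -/
theorem semigraphoidIdeal_eq : semigraphoidIdeal 4 = moveIdeal quads := by
  apply le_antisymm
  · rw [semigraphoidIdeal, Ideal.span_le]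
    rintro _ ⟨i, j, l, K, hij, hil, hjl, hi, hj, hl, rfl⟩
    obtain ⟨q, hq, h⟩ := quads_sound i j l K hij hil hjl hi hj hl
    have hmem := poly_mem_moveIdeal hq
    rw [SetLike.mem_coe, monomial_expo_pair, monomial_expo_pair, idx_ci, idx_ci, idx_ci, idx_ci]
    rcases h with ⟨h1, h2⟩ | ⟨h1, h2⟩
    · rw [Move.poly, expo_eq_of_sameList h1, expo_eq_of_sameList h2] at hmem
      exact hmem
    · rw [Move.poly, expo_eq_of_sameList h1, expo_eq_of_sameList h2] at hmem
      rw [binom_symm, neg_mem_iff] at hmem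
      exact hmem
  · refine moveIdeal_le fun q hq => ?_
    obtain ⟨i, j, l, K, hij, hil, hjl, hi, hj, hl, h1, h2⟩ := quads_complete q hq
    apply Ideal.subset_span
    refine ⟨i, j, l, K, hij, hil, hjl, hi, hj, hl, ?_⟩
    rw [monomial_expo_pair, monomial_expo_pair, idx_ci, idx_ci, idx_ci, idx_ci, Move.poly,
      expo_eq_of_sameList h1,
      expo_eq_of_sameList h2]
    rfl

theorem mem_markov_of_quads {m : Move} (h : m ∈ quads) : m ∈ markov :=
  List.mem_append_left _ h

theorem mem_markov_of_higher {h : List ℕ × List ℕ × ℕ × List (List ℕ)} (hh : h ∈ higher) :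
    (h.1, h.2.1) ∈ markov :=
  List.mem_append_right _ (List.mem_map_of_mem hh)

theorem mem_markov {m : Move} (hm : m ∈ markov) :
    m ∈ quads ∨ ∃ h ∈ higher, m = (h.1, h.2.1) := by
  rcases List.mem_append.1 hm with h | h
  · exact Or.inl h
  · obtain ⟨x, hx, rfl⟩ := List.mem_map.1 h
    exact Or.inr ⟨x, hx, rfl⟩

theorem X_mul_higher_mem {h : List ℕ × List ℕ × ℕ × List (List ℕ)} (hh : h ∈ higher) {c : CI 4}
    (hc : c ∈ maskSet h.2.2.1) :
    monomial (Finsupp.single c 1) 1 * binom (expo h.1) (expo h.2.1) ∈ semigraphoidIdeal 4 := by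
  obtain ⟨-, -, -, hpaths⟩ := higher_check h hh
  have hmem : idx c ∈ (List.range 24).filter h.2.2.1.testBit :=
    List.mem_filter.2 ⟨List.mem_range.2 (idx_lt c), hc⟩
  obtain ⟨k, hk, hkc⟩ := List.mem_iff_getElem.1 hmem
  have hp := (List.forall₂_iff_get.1 hpaths).2 k hk (by rw [← hpaths.length_eq]; exact hk)
  simp only [List.get_eq_getElem, hkc] at hp
  rw [← binom_add, ← expo_idx, ← expo_append, ← expo_append, semigraphoidIdeal_eq]
  exact binom_mem_of_connects (fun m hm => poly_mem_moveIdeal hm) hp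

/-! ### The toric parametrization and its kernel -/

/-- The exponents of the toric parametrization. -/
def row (c : CI 4) : Fin 11 →₀ ℕ :=
  Finsupp.equivFunOnFinite.symm fun r => if (col (idx c)).testBit r then 1 else 0

theorem row_apply (c : CI 4) (r : Fin 11) :
    row c r = if (col (idx c)).testBit r then 1 else 0 := rfl

theorem degreeMap_expo {l : List ℕ} (hl : ∀ n ∈ l, n < 24) (r : Fin 11) :
    degreeMap row (expo l) r = l.countP fun n => (col n).testBit r := by
  induction l with
  | nil => simp [expo_nil]
  | cons n l ih =>
    obtain ⟨c, rfl⟩ := exists_idx (hl n (by simp))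
    rw [expo_cons, map_add, Finsupp.add_apply, ih fun m hm => hl m (by simp [hm]), expo_idx,
      degreeMap_single, one_smul, row_apply, List.countP_cons, add_comm]

theorem degreeMap_expo_eq {a b : List ℕ} (ha : ∀ n ∈ a, n < 24) (hb : ∀ n ∈ b, n < 24)
    (h : sameDegree a b = true) : degreeMap row (expo a) = degreeMap row (expo b) := by
  ext r
  rw [degreeMap_expo ha, degreeMap_expo hb]
  have := List.all_eq_true.1 h r (List.mem_range.2 r.2)
  simpa using this

/-- The kernel of the toric parametrization. -/
def toricKernel : Ideal (Poly 4) := RingHom.ker (toricMap row)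

instance : toricKernel.IsPrime := isPrime_ker_toricMap row

theorem markov_mem_toricKernel {m : Move} (hm : m ∈ markov) : m.poly ∈ toricKernel := by
  obtain ⟨h1, h2, -, h3⟩ := markov_check m hm
  exact binom_mem_ker_toricMap.2 (degreeMap_expo_eq h1 h2 h3)

theorem semigraphoidIdeal_le_toricKernel : semigraphoidIdeal 4 ≤ toricKernel := by
  rw [semigraphoidIdeal_eq]
  exact moveIdeal_le fun m hm => markov_mem_toricKernel (mem_markov_of_quads hm)

theorem prod_X_notMem {P : Ideal (Poly 4)} [P.IsPrime] (h : ∀ c, X c ∉ P) :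
    (∏ c : CI 4, X c) ∉ P := by
  rw [Ideal.IsPrime.prod_mem_iff]
  rintro ⟨c, -, hc⟩
  exact h c hc

/-- A prime without unknowns does not contain their product, so powers of the product can be
cancelled modulo it. -/
theorem toricIdeal_le_of_prime {P : Ideal (Poly 4)} [hP : P.IsPrime] (h : ∀ c, X c ∉ P)
    (hle : semigraphoidIdeal 4 ≤ P) : toricIdeal 4 ≤ P := by
  rintro f ⟨N, hN⟩
  exact (hP.mem_or_mem (hle hN)).resolve_left fun h' => prod_X_notMem h (hP.mem_of_pow_mem N h')

theorem toricIdeal_le_toricKernel : toricIdeal 4 ≤ toricKernel :=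
  toricIdeal_le_of_prime (X_notMem_ker_toricMap row) semigraphoidIdeal_le_toricKernel

theorem moveIdeal_markov_le : moveIdeal markov ≤ toricIdeal 4 := by
  refine moveIdeal_le fun m hm => ?_
  rcases mem_markov hm with hq | ⟨h, hh, rfl⟩
  · refine ⟨0, ?_⟩
    rw [pow_zero, one_mul, semigraphoidIdeal_eq]
    exact poly_mem_moveIdeal hq
  · have hne : ∃ c, c ∈ maskSet h.2.2.1 := by
      have hM := (higher_check h hh).2.2.1
      -- Any quadric would do; it only exhibits an unknown in the mask. One such factor of the
      -- product of all unknowns brings the binomial into `I_SG`, so the exponent 1 suffices in the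
      -- saturation.
      obtain ⟨n, hn, hn'⟩ := (quads_hit ([1, 6], [0, 8]) (by decide) _ hM).1
      obtain ⟨c, rfl⟩ := exists_idx (n := n) (by
        simp only [List.mem_cons, List.not_mem_nil, or_false] at hn; omega)
      exact ⟨c, hn'⟩
    obtain ⟨c, hc⟩ := hne
    refine ⟨1, ?_⟩
    have hX : (monomial (Finsupp.single c 1) 1 : Poly 4) = X c := rfl
    rw [pow_one, ← Finset.mul_prod_erase _ _ (Finset.mem_univ c), mul_comm (X c), mul_assoc]
    exact Ideal.mul_mem_left _ _ (X_mul_higher_mem hh hc)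

/-! ### Reduction to standard monomials -/

/-- The weight of an exponent vector. -/
def weight (u : CI 4 →₀ ℕ) : ℕ := ∑ c, u c * wt (idx c)

theorem weight_add (u v : CI 4 →₀ ℕ) : weight (u + v) = weight u + weight v := by
  simp [weight, add_mul, Finset.sum_add_distrib]

theorem weight_expo {l : List ℕ} (hl : ∀ n ∈ l, n < 24) : weight (expo l) = (l.map wt).sum := by
  induction l with
  | nil => simp [expo_nil, weight]
  | cons n l ih =>
    obtain ⟨c, rfl⟩ := exists_idx (hl n (by simp))
    rw [expo_cons, weight_add, ih fun m hm => hl m (by simp [hm]), expo_idx, List.map_cons,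
      List.sum_cons]
    simp [weight, Finsupp.single_apply]

theorem degree_expo {l : List ℕ} (hl : ∀ n ∈ l, n < 24) : (expo l).degree = l.length := by
  induction l with
  | nil => simp [expo_nil]
  | cons n l ih =>
    obtain ⟨c, rfl⟩ := exists_idx (hl n (by simp))
    rw [expo_cons, map_add, ih fun m hm => hl m (by simp [hm]), expo_idx, List.length_cons,
      Finsupp.degree_single, add_comm]

/-- The sets that contain no leading monomial of the Gröbner basis. -/
def IsFace (s : Finset (CI 4)) : Prop := ∀ g ∈ groebner, ∃ c, idx c ∈ g.1 ∧ c ∉ s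

theorem IsFace.mono {s t : Finset (CI 4)} (ht : IsFace t) (h : s ⊆ t) : IsFace s := fun g hg => by
  obtain ⟨c, hc, hct⟩ := ht g hg
  exact ⟨c, hc, fun hcs => hct (h hcs)⟩

/-- Replacing a leading monomial by its partner lowers the weight, a natural number, so the
reduction stops at a standard monomial. The partners have equal length, which preserves the degree.
-/
theorem exists_standard (u : CI 4 →₀ ℕ) : ∃ v : CI 4 →₀ ℕ, IsFace v.support ∧
    v.degree = u.degree ∧ binom u v ∈ moveIdeal markov := by
  induction hw : weight u using Nat.strong_induction_on generalizing u with
  | _ n ih =>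
  by_cases hu : IsFace u.support
  · exact ⟨u, hu, rfl, by simp [binom]⟩
  · simp only [IsFace, not_forall, not_exists, not_and, not_not] at hu
    obtain ⟨g, hg, hsupp⟩ := hu
    obtain ⟨hnd, ha, hwt, hlen, hb, -, hconn⟩ := groebner_check g hg
    -- Leading monomials are squarefree, so containment of supports already gives divisibility.
    have hle : expo g.1 ≤ u := by
      intro c
      rw [expo_apply]
      by_cases hc : idx c ∈ g.1
      · rw [List.count_eq_one_of_mem hnd hc]
        exact Nat.one_le_iff_ne_zero.2 (Finsupp.mem_support_iff.1 (hsupp c hc))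
      · rw [List.count_eq_zero_of_not_mem hc]
        exact Nat.zero_le _
    obtain ⟨d, rfl⟩ := exists_add_of_le hle
    have hmem : binom (expo g.1) (expo g.2.1) ∈ moveIdeal markov :=
      binom_mem_of_connects (fun m hm => poly_mem_moveIdeal hm) hconn
    have hlt : weight (expo g.2.1 + d) < n := by
      rw [← hw, weight_add, weight_add, weight_expo ha, weight_expo hb]
      omega
    obtain ⟨v, hv, hdeg, hmem'⟩ := ih _ hlt _ rfl
    refine ⟨v, hv, ?_, ?_⟩
    · rw [hdeg, map_add, map_add, degree_expo ha, degree_expo hb, hlen]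
    · rw [← binom_trans _ (expo g.2.1 + d)]
      refine add_mem ?_ hmem'
      rw [add_comm (expo g.1), add_comm (expo g.2.1), binom_add]
      exact Ideal.mul_mem_left _ _ hmem

/-! ### The triangulation separates standard monomials -/

theorem value_eq (D : ℕ) (c : CI 4) : value D (idx c) = ∑ r, row c r * digit D r := by
  rw [value, rows_check _ (List.mem_range.2 (idx_lt c))]
  have h1 : ((List.range 11).filter (col (idx c)).testBit).Nodup := List.nodup_range.filter _
  rw [← List.sum_toFinset _ h1, List.toFinset_filter, Finset.sum_filter]
  have h2 : (List.range 11).toFinset = Finset.range 11 := by decide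
  rw [h2, Finset.sum_range]
  refine Finset.sum_congr rfl fun r _ => ?_
  rw [row_apply]
  split_ifs <;> simp

theorem sum_degreeMap_digit (D : ℕ) (u : CI 4 →₀ ℕ) :
    ∑ r, degreeMap row u r * digit D r = ∑ c, u c * value D (idx c) := by
  simp only [degreeMap_apply, Finsupp.finsetSum_apply, Finsupp.smul_apply, smul_eq_mul,
    Finset.sum_mul, value_eq, Finset.mul_sum]
  rw [Finset.sum_comm]
  simp only [mul_assoc]

theorem value_le {F : ℕ × ℕ} (hF : F ∈ facets) (c : CI 4) :
    value F.2 (idx c) ≤ wt (idx c) ∧ (value F.2 (idx c) = wt (idx c) ↔ c ∈ maskSet F.1) := by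
  have h := List.all_eq_true.1 (List.all_eq_true.1 facets_supporting F hF) (idx c)
    (List.mem_range.2 (idx_lt c))
  rw [mem_maskSet]
  split_ifs at h with hb
  · have := Nat.eq_of_beq_eq_true h
    simp [this, hb]
  · have := Nat.le_of_ble_eq_true h
    simp only [hb, Bool.false_eq_true, iff_false]
    omega

theorem sum_value_le {F : ℕ × ℕ} (hF : F ∈ facets) (u : CI 4 →₀ ℕ) :
    ∑ c, u c * value F.2 (idx c) ≤ weight u ∧
      (∑ c, u c * value F.2 (idx c) = weight u ↔ ∀ c ∈ u.support, c ∈ maskSet F.1) := by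
  have hle : ∀ c ∈ Finset.univ, u c * value F.2 (idx c) ≤ u c * wt (idx c) := fun c _ =>
    Nat.mul_le_mul_left _ (value_le hF c).1
  refine ⟨Finset.sum_le_sum hle, ?_⟩
  rw [weight, Finset.sum_eq_sum_iff_of_le hle]
  refine ⟨fun h c hc => ?_, fun h c _ => ?_⟩
  · exact (value_le hF c).2.1
      (Nat.eq_of_mul_eq_mul_left (Nat.pos_of_ne_zero (Finsupp.mem_support_iff.1 hc))
        (h c (Finset.mem_univ c)))
  · by_cases hc : u c = 0
    · simp [hc]
    · rw [(value_le hF c).2.2 (h c (Finsupp.mem_support_iff.2 hc))]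

/-- A bit of a mask as an element of `ZMod 2`. -/
def zbit (x r : ℕ) : ZMod 2 := if x.testBit r then 1 else 0

theorem zbit_xor (x y r : ℕ) : zbit (x ^^^ y) r = zbit x r + zbit y r := by
  simp only [zbit, Nat.testBit_xor]
  cases x.testBit r <;> cases y.testBit r <;> decide

/-- The first vector is the pivot. Its coefficient is determined by the others through the pivot
bit, so a relation among all vectors becomes a relation with the same coefficients among the reduced
remaining ones. -/
theorem eq_zero_of_independent {n : ℕ} {l : List (ZMod 2 × ℕ)}
    (h : independent n (l.map Prod.snd) = true)
    (hsum : ∀ r, (l.map fun p => p.1 * zbit p.2 r).sum = 0) : ∀ p ∈ l, p.1 = 0 := by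
  induction n generalizing l with
  | zero =>
    cases l with
    | nil => simp
    | cons p l => simp [independent] at h
  | succ n ih =>
    cases l with
    | nil => simp
    | cons q l =>
      obtain ⟨z, v⟩ := q
      simp only [List.map_cons, independent, Bool.and_eq_true, bne_iff_ne, List.sum_cons,
        List.map_map] at h hsum
      obtain ⟨hv, hind⟩ := h
      -- The pivot is the top bit of `v`, where `v` is certainly 1.
      set b := v.log2 with hb
      have hvb : zbit v b = 1 := by rw [zbit, if_pos (Nat.testBit_log2 hv)]
      let l' : List (ZMod 2 × ℕ) := l.map fun p =>
        (p.1, if p.2.testBit b then p.2 ^^^ v else p.2)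
      have hmap : l'.map Prod.snd =
          (l.map ((fun x => if x.testBit b then x ^^^ v else x) ∘ Prod.snd)) := by
        simp [l', Function.comp_def]
      have hbit : ∀ (p : ZMod 2 × ℕ) (r : ℕ),
          zbit (if p.2.testBit b then p.2 ^^^ v else p.2) r =
            zbit p.2 r + zbit p.2 b * zbit v r := by
        intro p r
        by_cases hp : p.2.testBit b = true
        · have : zbit p.2 b = 1 := by rw [zbit, if_pos hp]
          rw [if_pos hp, zbit_xor, this, one_mul]
        · have : zbit p.2 b = 0 := by rw [zbit, if_neg hp]
          rw [if_neg hp, this, zero_mul, add_zero]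
      have hsum' : ∀ r, (l'.map fun p => p.1 * zbit p.2 r).sum =
          (l.map fun p => p.1 * zbit p.2 r).sum +
            (l.map fun p => p.1 * zbit p.2 b).sum * zbit v r := by
        intro r
        rw [← List.sum_map_mul_right, ← List.sum_map_add]
        simp only [l', List.map_map, Function.comp_def, hbit, mul_add, mul_assoc]
      have hl' : ∀ p ∈ l', p.1 = 0 := by
        refine ih (by rw [hmap]; exact hind) fun r => ?_
        have h1 := hsum r
        have h2 := hsum b
        rw [hvb, mul_one] at h2
        rw [hsum', eq_neg_of_add_eq_zero_right h2, eq_neg_of_add_eq_zero_right h1,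
          neg_mul, ← neg_add]
        -- The original relation and the elimination correction both equal minus the pivot term;
        -- they cancel in characteristic 2.
        have : ∀ x : ZMod 2, -(x + x) = 0 := by decide
        exact this _
      have hl : ∀ p ∈ l, p.1 = 0 := by
        intro p hp
        exact hl' (p.1, if p.2.testBit b then p.2 ^^^ v else p.2)
          (List.mem_map.2 ⟨p, hp, rfl⟩)
      have hz : z = 0 := by
        have h2 := hsum b
        have h0 : (l.map fun p => p.1 * zbit p.2 b).sum = 0 :=
          List.sum_eq_zero fun x hx => by
            obtain ⟨p, hp, rfl⟩ := List.mem_map.1 hx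
            rw [hl p hp, zero_mul]
        rw [h0, hvb, mul_one, add_zero] at h2
        exact h2
      intro p hp
      rcases List.mem_cons.1 hp with rfl | hp
      · exact hz
      · exact hl p hp

theorem zbit_col (c : CI 4) (r : ℕ) :
    zbit (col (idx c)) r = if h : r < 11 then (row c ⟨r, h⟩ : ZMod 2) else 0 := by
  split_ifs with h
  · rw [zbit, row_apply]
    split_ifs <;> simp
  · rw [zbit, Nat.testBit_lt_two_pow ((col_lt _ (List.mem_range.2 (idx_lt c))).trans_le
      (Nat.pow_le_pow_right two_pos (not_lt.1 h)))]
    simp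

/-- Reduced modulo 2, `z` is a linear relation among the columns of a facet, and these are
independent over `ZMod 2`. -/
theorem even_of_sum_row_eq_zero {F : ℕ × ℕ} (hF : F ∈ facets) {z : CI 4 → ℤ}
    (hz : ∀ r, ∑ c, z c * (row c r : ℤ) = 0) (hsupp : ∀ c, c ∉ maskSet F.1 → z c = 0) (c : CI 4) :
    2 ∣ z c := by
  classical
  by_cases hc : c ∈ maskSet F.1
  · have : Nonempty (CI 4) := ⟨c⟩
    choose! e he using fun n (hn : n < 24) => exists_idx hn
    have hec : ∀ c, e (idx c) = c := fun c => idx_injective (he _ (idx_lt c))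
    let L := (List.range 24).filter F.1.testBit
    let l : List (ZMod 2 × ℕ) := L.map fun n => ((z (e n) : ZMod 2), col n)
    have hl : ∀ p ∈ l, p.1 = 0 := by
      refine eq_zero_of_independent (n := 11) ?_ fun r => ?_
      · have := facets_independent F hF
        simpa [l, L, List.map_map, Function.comp_def] using this
      · have h1 : (l.map fun p => p.1 * zbit p.2 r).sum =
            ∑ n ∈ Finset.range 24, if F.1.testBit n then (z (e n) : ZMod 2) * zbit (col n) r
              else 0 := by
          have hnd : L.Nodup := List.nodup_range.filter _
          have h2 : (List.range 24).toFinset = Finset.range 24 := by decide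
          rw [List.map_map, ← Finset.sum_filter, ← h2, ← List.toFinset_filter,
            List.sum_toFinset _ hnd]
          rfl
        rw [h1, ← sum_idx fun n => if F.1.testBit n then (z (e n) : ZMod 2) * zbit (col n) r
              else 0]
        have h3 : ∀ c, (if F.1.testBit (idx c) then (z (e (idx c)) : ZMod 2) *
            zbit (col (idx c)) r else 0) = z c * zbit (col (idx c)) r := by
          intro c
          split_ifs with h
          · rw [hec]
          · rw [hsupp c h, Int.cast_zero, zero_mul]
        rw [Finset.sum_congr rfl fun c _ => h3 c]
        by_cases hr : r < 11
        · have := congrArg (Int.cast : ℤ → ZMod 2) (hz ⟨r, hr⟩)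
          push_cast at this
          rw [← this]
          exact Finset.sum_congr rfl fun c _ => by rw [zbit_col, dif_pos hr]
        · exact Finset.sum_eq_zero fun c _ => by rw [zbit_col, dif_neg hr, mul_zero]
    have := hl (z (e (idx c)), col (idx c))
      (List.mem_map.2 ⟨idx c, List.mem_filter.2 ⟨List.mem_range.2 (idx_lt c), hc⟩, rfl⟩)
    rw [hec] at this
    exact (ZMod.intCast_zmod_eq_zero_iff_dvd _ 2).1 this
  · rw [hsupp c hc]
    exact dvd_zero 2

/-- Infinite descent: a relation has even entries, and half of it is again a relation on the same
facet. -/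
theorem eq_zero_of_sum_row_eq_zero {F : ℕ × ℕ} (hF : F ∈ facets) {z : CI 4 → ℤ}
    (hz : ∀ r, ∑ c, z c * (row c r : ℤ) = 0) (hsupp : ∀ c, c ∉ maskSet F.1 → z c = 0) (c : CI 4) :
    z c = 0 := by
  have key : ∀ (n : ℕ) (z : CI 4 → ℤ), (∀ r, ∑ c, z c * (row c r : ℤ) = 0) →
      (∀ c, c ∉ maskSet F.1 → z c = 0) → ∀ c, 2 ^ n ∣ z c := by
    intro n
    induction n with
    | zero => simp
    | succ n ih =>
      intro z hz hsupp c
      choose y hy using even_of_sum_row_eq_zero hF hz hsupp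
      have hdvd := ih y (fun r => by
        have := hz r
        simp only [hy, mul_assoc, ← Finset.mul_sum] at this
        simpa using this) (fun c hc => by
        have := hsupp c hc
        rw [hy] at this
        simpa using this) c
      rw [hy, pow_succ']
      exact mul_dvd_mul_left 2 hdvd
  by_contra hne
  -- Divisibility by `2 ^ |z c|` is already too much for a nonzero `z c`.
  have h1 := Int.le_of_dvd (abs_pos.2 hne) ((dvd_abs _ _).2 (key (z c).natAbs z hz hsupp c))
  have h2 : (z c).natAbs < 2 ^ (z c).natAbs := Nat.lt_two_pow_self
  have h3 : ((2 ^ (z c).natAbs : ℕ) : ℤ) ≤ ((z c).natAbs : ℤ) := by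
    push_cast
    exact h1
  exact absurd (by exact_mod_cast h3) (not_le.2 h2)

theorem exists_facet_of_branch {P : Prop} {s : ℕ → Prop} {k : ℕ → ℕ → Bool} {C : ℕ}
    (hC : ∀ n, C.testBit n = true → ¬ s n)
    (hk : ∀ C E, (∀ n, C.testBit n = true → ¬ s n) → (∀ n, E.testBit n = true → s n) →
      k C E = true → P) {N : List ℕ} {E : ℕ} (hE : ∀ n, E.testBit n = true → s n)
    (hN : ∃ b ∈ N, ¬ s b) (h : branch k C N E = true) : P := by
  have hor : ∀ (M b n : ℕ), (M ||| 1 <<< b).testBit n = true ↔ M.testBit n = true ∨ b = n := by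
    intro M b n
    rw [Nat.testBit_or, Bool.or_eq_true, Nat.one_shiftLeft, Nat.testBit_two_pow, decide_eq_true_iff]
  induction N generalizing E with
  | nil => simp at hN
  | cons b bs ih =>
    rw [branch, Bool.and_eq_true, Bool.or_eq_true] at h
    by_cases hb : s b
    · refine ih ?_ ?_ h.2
      · intro n hn
        rcases (hor _ _ _).1 hn with hn | rfl
        · exact hE n hn
        · exact hb
      · obtain ⟨b', hb', hs⟩ := hN
        rcases List.mem_cons.1 hb' with rfl | hb'
        · exact absurd hb hs
        · exact ⟨b', hb', hs⟩
    · refine hk _ _ ?_ hE (h.1.resolve_left fun h' => hb (hE b h'))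
      intro n hn
      rcases (hor _ _ _).1 hn with hn | rfl
      · exact hC n hn
      · exact hb

/-- A set that contains none of the `N` misses an element of each. Following its first missing
element along each list leads to a leaf where `C` lies outside the set and some `F` contains the
complement of `C`. -/
theorem exists_facet_of_covered {fs : List ℕ} {s : ℕ → Prop} (hs : ∀ n, s n → n < 24)
    {Ns : List (List ℕ)} (hNs : ∀ N ∈ Ns, ∃ b ∈ N, ¬ s b) {C E : ℕ}
    (hC : ∀ n, C.testBit n = true → ¬ s n) (hE : ∀ n, E.testBit n = true → s n)
    (h : covered fs Ns C E = true) : ∃ F ∈ fs, ∀ n, s n → F.testBit n = true := by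
  induction Ns generalizing C E with
  | nil =>
    rw [covered, List.any_eq_true] at h
    obtain ⟨F, hF, hFC⟩ := h
    refine ⟨F, hF, fun n hn => ?_⟩
    have hfull : (F ||| C).testBit n = true := by
      rw [Nat.eq_of_beq_eq_true hFC, show 16777215 = 2 ^ 24 - 1 from rfl,
        Nat.testBit_two_pow_sub_one]
      simpa using hs n hn
    rw [Nat.testBit_or, Bool.or_eq_true] at hfull
    exact hfull.resolve_right fun h' => hC n h' hn
  | cons N Ns ih =>
    rw [covered] at h
    have ih' := fun {C E} => @ih (fun N hN => hNs N (List.mem_cons_of_mem _ hN)) C E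
    split_ifs at h
    · exact ih' hC hE h
    · exact exists_facet_of_branch hC (fun C E hC hE h => ih' hC hE h) hE
        (hNs N List.mem_cons_self) h

theorem exists_facet {s : Finset (CI 4)} (hs : IsFace s) :
    ∃ F ∈ facets, ∀ c ∈ s, c ∈ maskSet F.1 := by
  obtain ⟨F, hF, h⟩ := exists_facet_of_covered (s := fun n => ∃ c ∈ s, idx c = n)
    (by rintro _ ⟨c, -, rfl⟩; exact idx_lt c) (fun N hN => by
      obtain ⟨g, hg, rfl⟩ := List.mem_map.1 hN
      obtain ⟨c, hc, hcs⟩ := hs g hg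
      refine ⟨idx c, hc, ?_⟩
      rintro ⟨d, hd, hdc⟩
      exact hcs (idx_injective hdc ▸ hd)) (by simp) (by simp) facets_cover
  obtain ⟨F', hF', rfl⟩ := List.mem_map.1 hF
  exact ⟨F', hF', fun c hc => h _ ⟨c, hc, rfl⟩⟩

/-- A functional of a facet bounds the weight from below, with equality exactly for supports in the
facet. Vectors with equal image have equal functional values, so both lie over one facet, whose
columns are independent. -/
theorem eq_of_degreeMap_eq {u v : CI 4 →₀ ℕ} (hu : IsFace u.support) (hv : IsFace v.support)
    (h : degreeMap row u = degreeMap row v) : u = v := by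
  obtain ⟨F, hF, hFu⟩ := exists_facet hu
  obtain ⟨F', hF', hFv⟩ := exists_facet hv
  have hval : ∀ D, ∑ c, u c * value D (idx c) = ∑ c, v c * value D (idx c) := fun D => by
    rw [← sum_degreeMap_digit, h, sum_degreeMap_digit]
  have h1 := (sum_value_le hF u).2.2 hFu
  have h2 := (sum_value_le hF' v).2.2 hFv
  have h3 := (sum_value_le hF v).1
  have h4 := (sum_value_le hF' u).1
  -- With `F` and `F'` also denoting their functionals: weight u = F(u) = F(v) ≤ weight v = F'(v) =
  -- F'(u) ≤ weight u, so equality holds throughout.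
  have h5 : ∀ c ∈ v.support, c ∈ maskSet F.1 := by
    refine (sum_value_le hF v).2.1 ?_
    have := hval F.2
    have := hval F'.2
    omega
  have hzero := eq_zero_of_sum_row_eq_zero hF (z := fun c => (u c : ℤ) - v c) (fun r => by
    have := congrArg (fun t => (t r : ℤ)) h
    simp only [degreeMap_apply, Finsupp.finsetSum_apply, Finsupp.smul_apply, smul_eq_mul,
      Nat.cast_sum, Nat.cast_mul] at this
    simp only [sub_mul, Finset.sum_sub_distrib, this, sub_self]) (fun c hc => by
    have hu0 : u c = 0 := by_contra fun hne => hc (hFu c (Finsupp.mem_support_iff.2 hne))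
    have hv0 : v c = 0 := by_contra fun hne => hc (h5 c (Finsupp.mem_support_iff.2 hne))
    simp [hu0, hv0])
  ext c
  have := hzero c
  omega

theorem eq_zero_of_toricMap_eq_zero {f : Poly 4} (hf : ∀ u ∈ f.support, IsFace u.support)
    (h : toricMap row f = 0) : f = 0 := by
  classical
  by_contra hne
  obtain ⟨w, hw⟩ := Finset.nonempty_iff_ne_empty.2 fun h' => hne (support_eq_empty.1 h')
  have h1 : toricMap row f = ∑ u ∈ f.support, monomial (degreeMap row u) (coeff u f) := by
    conv_lhs => rw [f.as_sum]
    rw [map_sum]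
    exact Finset.sum_congr rfl fun u _ => toricMap_monomial _ _ _
  have h2 := congrArg (coeff (degreeMap row w)) (h1.symm.trans h)
  rw [coeff_sum, Finset.sum_eq_single w, coeff_monomial, if_pos rfl, coeff_zero] at h2
  · exact mem_support_iff.1 hw h2
  · intro u hu huw
    rw [coeff_monomial, if_neg]
    exact fun h' => huw (eq_of_degreeMap_eq (hf u hu) (hf w hw) h')
  · exact fun h' => absurd hw h'

/-- Replacing each monomial of `f` by its standard form changes `f` by an element of the Markov
ideal. The result is a kernel element supported on standard monomials, whose images are distinct
monomials, so it vanishes. -/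
theorem toricKernel_le_moveIdeal : toricKernel ≤ moveIdeal markov := by
  intro f hf
  choose v hv _ hmem using exists_standard
  let g : Poly 4 := ∑ u ∈ f.support, monomial (v u) (coeff u f)
  have hfg : f - g ∈ moveIdeal markov := by
    have : f - g = ∑ u ∈ f.support, C (coeff u f) * binom u (v u) := by
      conv_lhs => rw [f.as_sum]
      rw [← Finset.sum_sub_distrib]
      refine Finset.sum_congr rfl fun u _ => ?_
      rw [binom, mul_sub, C_mul_monomial, C_mul_monomial, mul_one]
    rw [this]
    exact Ideal.sum_mem _ fun u _ => Ideal.mul_mem_left _ _ (hmem u)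
  have hle : moveIdeal markov ≤ toricKernel := moveIdeal_le fun m hm => markov_mem_toricKernel hm
  have hg : g ∈ toricKernel := by
    have := sub_mem hf (hle hfg)
    rwa [sub_sub_cancel] at this
  have hg0 : g = 0 := by
    refine eq_zero_of_toricMap_eq_zero (fun w hw => ?_) hg
    classical
    obtain ⟨u, -, hu⟩ := Finset.mem_biUnion.1 (support_sum hw)
    rw [Finset.mem_singleton.1 (support_monomial_subset hu)]
    exact hv u
  rwa [hg0, sub_zero] at hfg

theorem toricIdeal_eq_toricKernel : toricIdeal 4 = toricKernel :=
  le_antisymm toricIdeal_le_toricKernel (toricKernel_le_moveIdeal.trans moveIdeal_markov_le)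

theorem toricIdeal_eq_moveIdeal : toricIdeal 4 = moveIdeal markov :=
  le_antisymm (toricIdeal_le_toricKernel.trans toricKernel_le_moveIdeal) moveIdeal_markov_le

instance isPrime_toricIdeal : (toricIdeal 4).IsPrime := by
  rw [toricIdeal_eq_toricKernel]
  infer_instance

theorem X_notMem_toricIdeal (c : CI 4) : X c ∉ toricIdeal 4 := by
  rw [toricIdeal_eq_toricKernel]
  exact X_notMem_ker_toricMap row c

/-! ### Hilbert function and degree -/

open Classical in
/-- The exponent vectors of the standard monomials of degree `d`. -/
def standardExponents (d : ℕ) : Finset (CI 4 →₀ ℕ) :=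
  (Finset.univ.finsuppAntidiag d).filter fun v => IsFace v.support

theorem mem_finsuppAntidiag_univ {σ : Type*} [Fintype σ] [DecidableEq σ] {d : ℕ} {v : σ →₀ ℕ} :
    v ∈ (Finset.univ : Finset σ).finsuppAntidiag d ↔ v.degree = d := by
  rw [Finset.mem_finsuppAntidiag, Finsupp.degree_eq_sum]
  simp

theorem mem_standardExponents {d : ℕ} {v : CI 4 →₀ ℕ} :
    v ∈ standardExponents d ↔ v.degree = d ∧ IsFace v.support := by
  classical
  rw [standardExponents, Finset.mem_filter, mem_finsuppAntidiag_univ]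

/-- Standard monomials span each degree by reduction; they are independent because the
parametrization sends them to distinct monomials. -/
theorem hilbertFunction_toricIdeal (d : ℕ) :
    hilbertFunction (toricIdeal 4) d = (standardExponents d).card := by
  classical
  set q := (Ideal.Quotient.mkₐ ℚ (toricIdeal 4)).toLinearMap with hq
  have hspan : (homogeneousSubmodule (CI 4) ℚ d).map q =
      Submodule.span ℚ (Set.range fun v : standardExponents d => q (monomial v.1 1)) := by
    apply le_antisymm
    · rw [Submodule.map_le_iff_le_comap]
      intro f hf
      rw [Submodule.mem_comap, f.as_sum, map_sum]
      refine Submodule.sum_mem _ fun u hu => ?_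
      obtain ⟨v, hv, hdeg, hmem⟩ := exists_standard u
      have hud : u.degree = d := by
        have := hf (mem_support_iff.1 hu)
        rw [Finsupp.degree_eq_weight_one]
        exact this
      have h1 : q (monomial u 1) = q (monomial v 1) := by
        rw [← toricIdeal_eq_moveIdeal] at hmem
        exact Ideal.Quotient.eq.2 hmem
      have h2 : (monomial u (coeff u f) : Poly 4) = coeff u f • monomial u 1 := by
        rw [smul_monomial, smul_eq_mul, mul_one]
      rw [h2, map_smul, h1]
      exact Submodule.smul_mem _ _ (Submodule.subset_span
        ⟨⟨v, mem_standardExponents.2 ⟨hdeg.trans hud, hv⟩⟩, rfl⟩)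
    · rw [Submodule.span_le]
      rintro _ ⟨v, rfl⟩
      exact Submodule.mem_map_of_mem
        (isHomogeneous_monomial _ (mem_standardExponents.1 v.2).1)
  have hker : ∀ a ∈ toricIdeal 4, toricMap row a = 0 := fun a ha => by
    rw [toricIdeal_eq_toricKernel] at ha
    exact ha
  have hli : LinearIndependent ℚ fun v : standardExponents d => q (monomial v.1 1) := by
    refine LinearIndependent.of_comp (Ideal.Quotient.liftₐ (toricIdeal 4) (toricMap row)
      hker).toLinearMap ?_
    have : ((Ideal.Quotient.liftₐ (toricIdeal 4) (toricMap row) hker).toLinearMap ∘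
        fun v : standardExponents d => q (monomial v.1 1)) =
        (basisMonomials (Fin 11) ℚ) ∘ fun v : standardExponents d => degreeMap row v.1 := by
      funext v
      rw [Function.comp_apply, Function.comp_apply, coe_basisMonomials]
      exact toricMap_monomial _ _ _
    rw [this]
    refine (basisMonomials (Fin 11) ℚ).linearIndependent.comp _ fun v w hvw => ?_
    exact Subtype.ext (eq_of_degreeMap_eq (mem_standardExponents.1 v.2).2
      (mem_standardExponents.1 w.2).2 hvw)
  rw [hilbertFunction, hspan, finrank_span_eq_card hli, Fintype.card_coe]

theorem card_finsuppAntidiag_support_eq {σ : Type*} [Fintype σ] [DecidableEq σ] {s : Finset σ}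
    (hs : s.Nonempty) {d : ℕ} (hd : s.card ≤ d) :
    ((Finset.univ.finsuppAntidiag d).filter fun v : σ →₀ ℕ => v.support = s).card =
      (d - s.card + (s.card - 1)).choose (s.card - 1) := by
  -- Subtracting the indicator of `s` turns exact support `s` into support inside `s`; stars and
  -- bars then count.
  let o : σ →₀ ℕ := Finsupp.equivFunOnFinite.symm fun c => if c ∈ s then 1 else 0
  have ho : ∀ c, o c = if c ∈ s then 1 else 0 := fun _ => rfl
  have hodeg : o.degree = s.card := by
    rw [Finsupp.degree_eq_sum]
    simp [ho]
  have hcard : ((Finset.univ.finsuppAntidiag d).filter fun v : σ →₀ ℕ => v.support = s).card =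
      (s.finsuppAntidiag (d - s.card)).card := by
    symm
    refine Finset.card_bij (fun g _ => g + o) ?_ ?_ ?_
    · intro g hg
      rw [Finset.mem_finsuppAntidiag] at hg
      have hdeg : g.degree = d - s.card := by
        rw [← hg.1, Finsupp.degree_apply]
        exact Finset.sum_subset hg.2 fun c _ hc => Finsupp.notMem_support_iff.1 hc
      rw [Finset.mem_filter, mem_finsuppAntidiag_univ, map_add, hodeg, hdeg]
      refine ⟨by omega, ?_⟩
      ext c
      rw [Finsupp.mem_support_iff, Finsupp.add_apply, ho]
      by_cases hc : c ∈ s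
      · simp [hc]
      · have : g c = 0 := Finsupp.notMem_support_iff.1 fun h => hc (hg.2 h)
        simp [hc, this]
    · intro g _ g' _ h
      exact add_right_cancel h
    · intro v hv
      rw [Finset.mem_filter, mem_finsuppAntidiag_univ] at hv
      obtain ⟨hvd, rfl⟩ := hv
      have hle : o ≤ v := by
        intro c
        rw [ho]
        split_ifs with hc
        · exact Nat.one_le_iff_ne_zero.2 (Finsupp.mem_support_iff.1 hc)
        · exact Nat.zero_le _
      obtain ⟨g, hg⟩ := exists_add_of_le hle
      have hsub : g.support ⊆ v.support := by
        intro c hc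
        have : v c = o c + g c := by
          conv_lhs => rw [hg]
          rfl
        rw [Finsupp.mem_support_iff] at hc ⊢
        omega
      refine ⟨g, ?_, by rw [add_comm]; exact hg.symm⟩
      rw [Finset.mem_finsuppAntidiag]
      refine ⟨?_, hsub⟩
      have h1 : g.degree = ∑ c ∈ v.support, g c := by
        rw [Finsupp.degree_apply]
        exact Finset.sum_subset hsub fun c _ hc => Finsupp.notMem_support_iff.1 hc
      have h2 : v.degree = o.degree + g.degree := by
        conv_lhs => rw [hg]
        rw [map_add]
      rw [← h1]
      omega
  have hpos := hs.card_pos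
  rw [hcard, Finset.card_finsuppAntidiag_nat_eq_choose,
    show s.card + (d - s.card) - 1 = d - s.card + (s.card - 1) by omega]
  exact (Nat.choose_symm_add).symm ▸ rfl

/-- The set of statements of a bit mask, as a finite set. -/
def maskFinset (M : ℕ) : Finset (CI 4) := Finset.univ.filter fun c => M.testBit (idx c) = true

theorem mem_maskFinset {M : ℕ} {c : CI 4} : c ∈ maskFinset M ↔ c ∈ maskSet M := by
  simp [maskFinset, mem_maskSet]

theorem coe_maskFinset (M : ℕ) : (maskFinset M : Set (CI 4)) = maskSet M := by
  ext c
  exact mem_maskFinset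

theorem facet_mask {F : ℕ × ℕ} (hF : F ∈ facets) : F.1 < 2 ^ 24 ∧ (maskFinset F.1).card = 11 := by
  have := facets_sorted.2 F.1 (List.mem_map_of_mem hF)
  exact ⟨this.1, (card_filter_testBit F.1).trans this.2⟩

theorem isFace_facet {F : ℕ × ℕ} (hF : F ∈ facets) : IsFace (maskFinset F.1) := by
  intro g hg
  have h := List.all_eq_true.1 (List.all_eq_true.1 facets_standard F hF) g hg
  obtain ⟨n, hn, hb⟩ := List.any_eq_true.1 h
  obtain ⟨c, rfl⟩ := exists_idx ((groebner_check g hg).2.1 n hn)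
  refine ⟨c, hn, fun hc => ?_⟩
  rw [mem_maskFinset, mem_maskSet] at hc
  simp [hc] at hb

theorem exists_facet_superset {s : Finset (CI 4)} (hs : IsFace s) :
    ∃ F ∈ facets, s ⊆ maskFinset F.1 := by
  obtain ⟨F, hF, h⟩ := exists_facet hs
  exact ⟨F, hF, fun c hc => mem_maskFinset.2 (h c hc)⟩

open Classical in
-- A face of size 11 lies in a facet, which also has size 11, so the two coincide.
theorem card_faces :
    ((Finset.univ.filter IsFace).filter fun s => s.card = 11).card = 396 := by
  have h1 : ((Finset.univ.filter IsFace).filter fun s => s.card = 11) =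
      ((facets.map Prod.fst).toFinset).image maskFinset := by
    ext s
    simp only [Finset.mem_filter, Finset.mem_univ, true_and, Finset.mem_image, List.mem_toFinset,
      List.mem_map]
    constructor
    · rintro ⟨hs, hcard⟩
      obtain ⟨F, hF, hsF⟩ := exists_facet_superset hs
      exact ⟨F.1, ⟨F, hF, rfl⟩,
        (Finset.eq_of_subset_of_card_le hsF (by rw [(facet_mask hF).2, hcard])).symm⟩
    · rintro ⟨_, ⟨F, hF, rfl⟩, rfl⟩
      exact ⟨isFace_facet hF, (facet_mask hF).2⟩
  have hnd : (facets.map Prod.fst).Nodup := facets_sorted.1.imp fun h => h.ne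
  rw [h1, Finset.card_image_of_injOn, List.toFinset_card_of_nodup hnd, List.length_map,
    facets_length]
  intro M hM N hN h
  rw [Finset.mem_coe, List.mem_toFinset] at hM hN
  refine maskSet_injOn (facets_sorted.2 M hM).1 (facets_sorted.2 N hN).1 ?_
  rw [← coe_maskFinset, ← coe_maskFinset, h]

theorem card_le_of_isFace {s : Finset (CI 4)} (hs : IsFace s) : s.card ≤ 11 := by
  obtain ⟨F, hF, hsF⟩ := exists_facet_superset hs
  exact (Finset.card_le_card hsF).trans (facet_mask hF).2.le

theorem hasDegree_toricIdeal : HasDegree (toricIdeal 4) 396 := by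
  classical
  -- The empty face carries only the monomial 1, which is absent in positive degree; discarding it
  -- keeps `s.card - 1` from truncating.
  let Δ : Finset (Finset (CI 4)) := (Finset.univ.filter IsFace).filter Finset.Nonempty
  let p : Polynomial ℚ := ∑ s ∈ Δ, Polynomial.preHilbertPoly ℚ (s.card - 1) s.card
  have hΔ : ∀ s ∈ Δ, IsFace s ∧ 0 < s.card ∧ s.card ≤ 11 := fun s hs => by
    simp only [Δ, Finset.mem_filter, Finset.mem_univ, true_and] at hs
    exact ⟨hs.1, hs.2.card_pos, card_le_of_isFace hs.1⟩
  have hcoeff : p.coeff 10 = 396 * ((Nat.factorial 10 : ℕ) : ℚ)⁻¹ := by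
    have h1 : ∀ s ∈ Δ, (Polynomial.preHilbertPoly ℚ (s.card - 1) s.card).coeff 10 =
        if s.card = 11 then ((Nat.factorial 10 : ℕ) : ℚ)⁻¹ else 0 := by
      intro s hs
      have := hΔ s hs
      split_ifs with h
      · rw [h]
        exact Polynomial.coeff_preHilbertPoly_self ℚ 10 11
      · apply Polynomial.coeff_eq_zero_of_natDegree_lt
        rw [Polynomial.natDegree_preHilbertPoly]
        omega
    have h2 : Δ.filter (fun s => s.card = 11) =
        (Finset.univ.filter IsFace).filter fun s => s.card = 11 := by
      ext s
      simp only [Δ, Finset.mem_filter, Finset.mem_univ, true_and]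
      constructor
      · exact fun h => ⟨h.1.1, h.2⟩
      · exact fun h => ⟨⟨h.1, Finset.card_pos.1 (by omega)⟩, h.2⟩
    rw [Polynomial.finsetSum_coeff, Finset.sum_congr rfl h1, ← Finset.sum_filter, h2,
      Finset.sum_const, card_faces, nsmul_eq_mul]
    norm_num
  have hcoeff0 : p.coeff 10 ≠ 0 := by
    rw [hcoeff]
    positivity
  have hdeg : p.natDegree = 10 := by
    apply le_antisymm
    · refine Polynomial.natDegree_sum_le_of_forall_le _ _ fun s hs => ?_
      rw [Polynomial.natDegree_preHilbertPoly]
      have := hΔ s hs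
      omega
    · exact Polynomial.le_natDegree_of_ne_zero hcoeff0
  refine ⟨p, fun h => hcoeff0 (by rw [h, Polynomial.coeff_zero]), ?_, ?_⟩
  -- Faces have at most 11 elements, so from degree 11 on the binomial count is valid for every
  -- face.
  · filter_upwards [Filter.eventually_ge_atTop 11] with d hd
    rw [hilbertFunction_toricIdeal,
      Finset.card_eq_sum_card_fiberwise (f := Finsupp.support) (t := Δ)]
    · rw [Polynomial.eval_finsetSum]
      push_cast
      refine Finset.sum_congr rfl fun s hs => ?_
      obtain ⟨hface, hpos, hle⟩ := hΔ s hs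
      rw [Polynomial.preHilbertPoly_eq_choose_sub_add ℚ _ (hle.trans hd),
        ← card_finsuppAntidiag_support_eq (Finset.card_pos.1 hpos) (hle.trans hd)]
      congr 2
      ext v
      simp only [Finset.mem_filter, mem_standardExponents, mem_finsuppAntidiag_univ]
      exact ⟨fun h => ⟨h.1.1, h.2⟩, fun h => ⟨⟨h.1, h.2 ▸ hface⟩, h.2⟩⟩
    · intro v hv
      obtain ⟨hvd, hvs⟩ := mem_standardExponents.1 (Finset.mem_coe.1 hv)
      simp only [Δ, Finset.coe_filter, Finset.mem_filter, Finset.mem_univ, true_and,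
        Set.mem_ofPred_eq]
      refine ⟨hvs, Finset.nonempty_iff_ne_empty.2 fun h => ?_⟩
      rw [Finsupp.support_eq_empty.1 h, map_zero] at hvd
      omega
  · rw [Polynomial.leadingCoeff, hdeg, hcoeff]
    have : ((Nat.factorial 10 : ℕ) : ℚ) ≠ 0 := by positivity
    push_cast
    field_simp

/-! ### Codimension of the toric ideal -/

/-- The toric parametrization together with the unknowns at the listed positions. -/
def extendedRow (L : List ℕ) (c : CI 4) : Fin 11 ⊕ CI 4 →₀ ℕ :=
  (row c).mapDomain Sum.inl + if idx c ∈ L then Finsupp.single (Sum.inr c) 1 else 0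

theorem ker_toricMap_le {σ τ υ : Type*} {r : σ → τ →₀ ℕ} {r' : σ → υ →₀ ℕ}
    (ψ : MvPolynomial τ ℚ →ₐ[ℚ] MvPolynomial υ ℚ)
    (h : ∀ c, ψ (monomial (r c) 1) = monomial (r' c) 1) :
    RingHom.ker (toricMap r) ≤ RingHom.ker (toricMap r') := by
  have hcomp : toricMap r' = ψ.comp (toricMap r) := by
    ext c : 1
    simp [toricMap, h]
  intro f hf
  rw [RingHom.mem_ker, hcomp, AlgHom.comp_apply, RingHom.mem_ker.1 hf, map_zero]

theorem monomial_extendedRow (L : List ℕ) (c : CI 4) :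
    (monomial (extendedRow L c) 1 : MvPolynomial (Fin 11 ⊕ CI 4) ℚ) =
      rename Sum.inl (monomial (row c) 1) * if idx c ∈ L then X (Sum.inr c) else 1 := by
  rw [extendedRow, ← one_mul (1 : ℚ), ← monomial_mul, rename_monomial, one_mul]
  congr 1
  split_ifs <;> rfl

/-- Setting the extra coordinates outside `L` to 1 factors the smaller parametrization through the
larger one. -/
theorem ker_extendedRow_le (n : ℕ) (L : List ℕ) :
    RingHom.ker (toricMap (extendedRow (n :: L))) ≤ RingHom.ker (toricMap (extendedRow L)) := by
  refine ker_toricMap_le (aeval fun t => Sum.elim (fun r => X (Sum.inl r))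
    (fun c => if idx c ∈ L then X (Sum.inr c) else 1) t) fun c => ?_
  rw [monomial_extendedRow, monomial_extendedRow, map_mul, aeval_rename]
  congr 1
  · rw [rename_eq_aeval]
    rfl
  · by_cases h : idx c ∈ L
    · simp [h]
    · by_cases h' : idx c = n <;> simp [h, h']

theorem ker_extendedRow_nil_le :
    RingHom.ker (toricMap (extendedRow [])) ≤ RingHom.ker (toricMap row) := by
  refine ker_toricMap_le (aeval fun t => Sum.elim X (fun _ => 1) t) fun c => ?_
  rw [monomial_extendedRow, map_mul, aeval_rename]
  simp [Function.comp_def]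

theorem degreeMap_extendedRow_inr (L : List ℕ) (u : CI 4 →₀ ℕ) (c : CI 4) :
    degreeMap (extendedRow L) u (Sum.inr c) = if idx c ∈ L then u c else 0 := by
  rw [degreeMap_apply, Finsupp.finsetSum_apply, Finset.sum_eq_single c]
  · rw [Finsupp.smul_apply, extendedRow, Finsupp.add_apply,
      Finsupp.mapDomain_of_notMem_range _ _ (by simp)]
    split_ifs <;> simp
  · intro d _ hd
    rw [Finsupp.smul_apply, extendedRow, Finsupp.add_apply,
      Finsupp.mapDomain_of_notMem_range _ _ (by simp)]
    split_ifs <;> simp [hd]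
  · simp

theorem degreeMap_extendedRow_inl (L : List ℕ) (u : CI 4 →₀ ℕ) (r : Fin 11) :
    degreeMap (extendedRow L) u (Sum.inl r) = degreeMap row u r := by
  rw [degreeMap_apply, degreeMap_apply, Finsupp.finsetSum_apply, Finsupp.finsetSum_apply]
  refine Finset.sum_congr rfl fun c _ => ?_
  rw [Finsupp.smul_apply, Finsupp.smul_apply, extendedRow, Finsupp.add_apply,
    Finsupp.mapDomain_apply Sum.inl_injective]
  split_ifs <;> simp

/-- Remembering one more unknown makes the kernel strictly smaller: the binomial of that entry
avoids the unknowns remembered so far, hence is in the old kernel, but it has unequal exponents at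
the new unknown. Every entry thus adds a step to a chain of primes. -/
theorem length_le_height_of_triangular {l : List (ℕ × Move)} (h : triangular l = true) :
    ((l.map Prod.fst).length : ℕ∞) +
      (RingHom.ker (toricMap (extendedRow (l.map Prod.fst)))).height ≤
      (RingHom.ker (toricMap (extendedRow []))).height := by
  induction l with
  | nil => simp
  | cons x rest ih =>
    obtain ⟨n, m⟩ := x
    simp only [triangular, Bool.and_eq_true, decide_eq_true_iff, bne_iff_ne, List.all_eq_true,
      Bool.not_eq_true', List.contains_eq_mem, decide_eq_false_iff_not] at h
    obtain ⟨⟨⟨⟨hn, hdeg⟩, hcount⟩, hmem⟩, hrest⟩ := h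
    obtain ⟨c, rfl⟩ := exists_idx hn
    refine le_trans ?_ (ih hrest)
    have hm1 : ∀ k ∈ m.1, k < 24 := fun k hk => (hmem k (List.mem_append_left _ hk)).1
    have hm2 : ∀ k ∈ m.2, k < 24 := fun k hk => (hmem k (List.mem_append_right _ hk)).1
    have hlt : RingHom.ker (toricMap (extendedRow (idx c :: rest.map Prod.fst))) <
        RingHom.ker (toricMap (extendedRow (rest.map Prod.fst))) := by
      refine lt_of_le_not_ge (ker_extendedRow_le _ _) fun hle => ?_
      have h1 : m.poly ∈ RingHom.ker (toricMap (extendedRow (rest.map Prod.fst))) := by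
        refine binom_mem_ker_toricMap.2 ?_
        ext t
        rcases t with r | d
        · rw [degreeMap_extendedRow_inl, degreeMap_extendedRow_inl,
            degreeMap_expo_eq hm1 hm2 hdeg]
        · rw [degreeMap_extendedRow_inr, degreeMap_extendedRow_inr]
          split_ifs with hd
          · rw [expo_apply, expo_apply, List.count_eq_zero_of_not_mem,
              List.count_eq_zero_of_not_mem]
            · exact fun hk => (hmem _ (List.mem_append_right _ hk)).2 hd
            · exact fun hk => (hmem _ (List.mem_append_left _ hk)).2 hd
          · rfl
      have h2 := binom_mem_ker_toricMap.1 (hle h1)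
      have h3 := congrArg (fun t => t (Sum.inr c)) h2
      simp only [degreeMap_extendedRow_inr, List.mem_cons, true_or, if_true] at h3
      exact hcount h3
    have := Ideal.height_add_one_le_of_lt_of_isPrime hlt
    rw [List.map_cons, List.length_cons, Nat.cast_add, Nat.cast_one, add_assoc]
    gcongr
    rw [add_comm]
    exact this

theorem le_height_toricIdeal : 13 ≤ (toricIdeal 4).height := by
  have h := length_le_height_of_triangular chain_check.1
  rw [List.length_map, chain_check.2] at h
  rw [toricIdeal_eq_toricKernel]
  exact (le_self_add.trans h).trans (Ideal.height_mono ker_extendedRow_nil_le)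

/-- A prime without unknowns permits division by the unknown of each entry, and each binomial so
obtained is available to the later ones. -/
theorem quads_mem_of_derivable {P : Ideal (Poly 4)} [hP : P.IsPrime] (hX : ∀ c, X c ∉ P)
    {rest : List (Move × ℕ × List ℕ)} {L : List Move} (hL : ∀ m ∈ L, m.poly ∈ P)
    (h : derivable L rest = true) : ∀ r ∈ rest, r.1.poly ∈ P := by
  induction rest generalizing L with
  | nil => simp
  | cons x rest ih =>
    obtain ⟨m, i, p⟩ := x
    simp only [derivable, Bool.and_eq_true, decide_eq_true_iff] at h
    obtain ⟨⟨hi, hp⟩, hrest⟩ := h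
    obtain ⟨c, rfl⟩ := exists_idx hi
    have hm : m.poly ∈ P := by
      have := binom_mem_of_connects hL hp
      rw [expo_cons, expo_cons (idx c) m.2, binom_add, expo_idx] at this
      exact (hP.mem_or_mem this).resolve_left (hX c)
    intro r hr
    rcases List.mem_cons.1 hr with rfl | hr
    · exact hm
    · refine ih (L := m :: L) (fun m' hm' => ?_) hrest r hr
      rcases List.mem_cons.1 hm' with rfl | hm'
      · exact hm
      · exact hL m' hm'

/-- By Krull's theorem it suffices that the toric ideal is minimal over 13 elements. A prime below
it contains no unknown, so once it contains `latticeBasis` it contains all of `I_SG`, and hence the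
saturation. -/
theorem height_toricIdeal_le : (toricIdeal 4).height ≤ 13 := by
  classical
  let s : Finset (Poly 4) := (latticeBasis.map Move.poly).toFinset
  have hs : ∀ f ∈ s, ∃ m ∈ latticeBasis, f = m.poly := fun f hf => by
    obtain ⟨m, hm, rfl⟩ := List.mem_map.1 (List.mem_toFinset.1 hf)
    exact ⟨m, hm, rfl⟩
  have hmin : toricIdeal 4 ∈ (Ideal.span (s : Set (Poly 4))).minimalPrimes := by
    refine ⟨⟨isPrime_toricIdeal, ?_⟩, ?_⟩
    · rw [Ideal.span_le]
      intro f hf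
      obtain ⟨m, hm, rfl⟩ := hs f hf
      rw [toricIdeal_eq_moveIdeal]
      exact poly_mem_moveIdeal (mem_markov_of_quads (latticeBasis_check.1 m hm))
    · rintro Q ⟨hQ, hsQ⟩ hle
      have hX : ∀ c, X c ∉ Q := fun c hc => X_notMem_toricIdeal c (hle hc)
      have hbasis : ∀ m ∈ latticeBasis, m.poly ∈ Q := fun m hm => hsQ (Ideal.subset_span (by
        rw [Finset.mem_coe, List.mem_toFinset]
        exact List.mem_map_of_mem hm))
      have hrest := quads_mem_of_derivable hX hbasis latticeBasis_check.2.2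
      refine toricIdeal_le_of_prime hX ?_
      rw [semigraphoidIdeal_eq]
      refine moveIdeal_le fun q hq => ?_
      rcases latticeRest_check q hq with h | ⟨r, hr, rfl⟩
      · exact hbasis q h
      · exact hrest r hr
  refine (Ideal.height_le_card_of_mem_minimalPrimes_span_finset hmin).trans ?_
  have := (List.toFinset_card_le (latticeBasis.map Move.poly)).trans_eq
    ((List.length_map _).trans latticeBasis_check.2.1)
  exact_mod_cast this

theorem height_toricIdeal : (toricIdeal 4).height = 13 :=
  le_antisymm height_toricIdeal_le le_height_toricIdeal

/-! ### The monomial primes and their symmetry classes -/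

/-- The monomial prime of a bit mask. -/
def maskIdeal (M : ℕ) : Ideal (Poly 4) := variableIdeal (maskSet M)

theorem maskIdeal_eq (M : ℕ) : maskIdeal M = varIdeal (maskSet M) := rfl

instance isPrime_maskIdeal (M : ℕ) : (maskIdeal M).IsPrime := isPrime_varIdeal _

/-- The monomial primes of a list of masks. -/
def maskIdeals (L : List ℕ) : Set (Ideal (Poly 4)) := maskIdeal '' {M | M ∈ L}

theorem primes12_eq : primes12 = maskIdeals [16515135, 262080] := by
  have h1 : {c : CI 4 | c.1.2.card = 0 ∨ c.1.2.card = 2} = maskSet 16515135 := by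
    ext c
    change (c.1.2.card = 0 ∨ c.1.2.card = 2) ↔ Nat.testBit 16515135 (idx c) = true
    revert c
    decide +kernel
  have h2 : {c : CI 4 | c.1.2.card = 1} = maskSet 262080 := by
    ext c
    change c.1.2.card = 1 ↔ Nat.testBit 262080 (idx c) = true
    revert c
    decide +kernel
  rw [primes12, h1, h2]
  ext P
  simp [maskIdeals, maskIdeal, eq_comm]

theorem relabel_bijective (σ : Equiv.Perm (Fin 4)) : Function.Bijective (relabel σ) := by
  rw [← Finite.injective_iff_bijective]
  intro c d h
  have h1 := congrArg (fun x => x.1.1) h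
  have h2 := congrArg (fun x => x.1.2) h
  exact Subtype.ext (Prod.ext (Finset.map_injective _ h1) (Finset.map_injective _ h2))

/-- Since relabeling is bijective, an image equals a mask set as soon as membership agrees
pointwise, which can be evaluated. -/
theorem symmetryClass_eq {T : Set (CI 4)} {U : ℕ} {L : List ℕ} (hT : T = maskSet U)
    (h1 : ∀ σ : Equiv.Perm (Fin 4), ∃ M ∈ L, ∀ c : CI 4,
      U.testBit (idx c) = M.testBit (idx (relabel σ c)))
    (h2 : ∀ M ∈ L, ∃ σ : Equiv.Perm (Fin 4), ∀ c : CI 4,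
      U.testBit (idx c) = M.testBit (idx (relabel σ c))) :
    symmetryClass T = maskIdeals L := by
  have key : ∀ (σ : Equiv.Perm (Fin 4)) (M : ℕ),
      (∀ c : CI 4, U.testBit (idx c) = M.testBit (idx (relabel σ c))) →
        relabel σ '' T = maskSet M := by
    intro σ M h
    have : T = relabel σ ⁻¹' maskSet M := by
      rw [hT]
      ext c
      rw [Set.mem_preimage, mem_maskSet, mem_maskSet, h]
    rw [this, Set.image_preimage_eq _ (relabel_bijective σ).2]
  ext P
  constructor
  · rintro ⟨σ, rfl⟩
    obtain ⟨M, hM, h⟩ := h1 σ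
    exact ⟨M, hM, congrArg variableIdeal (key σ M h).symm⟩
  · rintro ⟨M, hM, rfl⟩
    obtain ⟨σ, h⟩ := h2 M hM
    exact ⟨σ, congrArg variableIdeal (key σ M h)⟩

set_option synthInstance.maxSize 1000 in
set_option synthInstance.maxHeartbeats 400000 in
theorem primes15_eq : primes15 = maskIdeals masks15 := by
  -- The mask of `unknowns15`, itself an entry of `masks15`.
  refine symmetryClass_eq (U := 15115751) ?_ ?_ ?_
  · ext c
    rw [mem_maskSet]
    simp only [unknowns15, Set.mem_insert_iff, Set.mem_singleton_iff]
    revert c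
    decide +kernel
  · decide +kernel
  · decide +kernel

set_option synthInstance.maxSize 1000 in
set_option synthInstance.maxHeartbeats 400000 in
theorem primes16_eq : primes16 = maskIdeals masks16 := by
  -- The mask of `unknowns16`, itself an entry of `masks16`.
  refine symmetryClass_eq (U := 13616115) ?_ ?_ ?_
  · ext c
    rw [mem_maskSet]
    simp only [unknowns16, Set.mem_insert_iff, Set.mem_singleton_iff]
    revert c
    decide +kernel
  · decide +kernel
  · decide +kernel

theorem maskIdeals_append (L L' : List ℕ) :
    maskIdeals (L ++ L') = maskIdeals L ∪ maskIdeals L' := by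
  rw [maskIdeals, maskIdeals, maskIdeals, ← Set.image_union]
  congr 1
  ext M
  simp

theorem monomialPrimes_eq : monomialPrimes = maskIdeals primeMasks := by
  rw [monomialPrimes, primes12_eq, primes15_eq, primes16_eq, primeMasks, maskIdeals_append,
    maskIdeals_append]

theorem ncard_maskIdeals {L : List ℕ} (h : L.Nodup) (hlt : ∀ M ∈ L, M < 2 ^ 24) :
    (maskIdeals L).ncard = L.length := by
  have hL : {M | M ∈ L} = (L.toFinset : Set ℕ) := by
    ext M
    simp
  rw [maskIdeals, Set.InjOn.ncard_image, hL, Set.ncard_coe_finset,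
    List.toFinset_card_of_nodup h]
  intro M hM N hN hMN
  exact maskSet_injOn (hlt M hM) (hlt N hN) (varIdeal_injective hMN)

theorem height_of_mem_maskIdeals {L : List ℕ} {k : ℕ} (h : ∀ M ∈ L, maskCard M = k) :
    ∀ P ∈ maskIdeals L, P.height = k := by
  rintro _ ⟨M, hM, rfl⟩
  rw [maskIdeal_eq, height_varIdeal, ncard_maskSet, h M hM]

theorem poly_mem_maskIdeal {M : ℕ} (hM : M ∈ primeMasks) {q : Move} (hq : q ∈ quads) :
    q.poly ∈ maskIdeal M := by
  obtain ⟨h1, h2, -, -⟩ := markov_check q (mem_markov_of_quads hq)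
  obtain ⟨h3, h4⟩ := quads_hit q hq M hM
  rw [maskIdeal_eq, Move.poly, binom]
  exact sub_mem (monomial_mem_varIdeal.2 ((expo_hits_maskSet h1).2 h3))
    (monomial_mem_varIdeal.2 ((expo_hits_maskSet h2).2 h4))

theorem semigraphoidIdeal_le_maskIdeal {M : ℕ} (hM : M ∈ primeMasks) :
    semigraphoidIdeal 4 ≤ maskIdeal M := by
  rw [semigraphoidIdeal_eq]
  exact moveIdeal_le fun q hq => poly_mem_maskIdeal hM hq

/-! ### Prime decomposition of the semigraphoid ideal -/

/-- The exponent vectors of the monomials in all monomial primes. -/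
def InAllPrimes (u : CI 4 →₀ ℕ) : Prop := ∀ M ∈ primeMasks, ∃ c ∈ maskSet M, u c ≠ 0

/-- Such a binomial lies in every monomial prime, so each prime contains both monomials or neither;
the projection keeps the binomial or kills it. -/
theorem monomialProj_binom_mem {u v : CI 4 →₀ ℕ} (h : binom u v ∈ semigraphoidIdeal 4) :
    monomialProj InAllPrimes (binom u v) ∈ semigraphoidIdeal 4 := by
  classical
  have hiff : InAllPrimes u ↔ InAllPrimes v := by
    refine forall₂_congr fun M hM => ?_
    have hmem := semigraphoidIdeal_le_maskIdeal hM h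
    rw [← monomial_mem_varIdeal, ← monomial_mem_varIdeal, ← maskIdeal_eq]
    rw [binom] at hmem
    exact ⟨fun hu => by simpa using sub_mem hu hmem, fun hv => by simpa using add_mem hmem hv⟩
  have heq : monomialProj InAllPrimes (binom u v) = if InAllPrimes u then binom u v else 0 := by
    rw [binom, map_sub, monomialProj_monomial, monomialProj_monomial]
    by_cases hu : InAllPrimes u
    · simp [hu, hiff.1 hu]
    · simp [hu, mt hiff.2 hu]
  rw [heq]
  split_ifs
  · exact h
  · exact zero_mem _

/-- For a binomial of higher degree with attached prime `P`: if `x^d` involves an unknown of `P`,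
the product is in `I_SG`; otherwise neither of its monomials lies in `P`, and the projection is
zero. -/
theorem monomialProj_markov_mem {m : Move} (hm : m ∈ markov) (d : CI 4 →₀ ℕ) :
    monomialProj InAllPrimes (monomial d 1 * m.poly) ∈ semigraphoidIdeal 4 := by
  classical
  rcases mem_markov hm with hq | ⟨h, hh, rfl⟩
  · rw [Move.poly, ← binom_add]
    apply monomialProj_binom_mem
    rw [binom_add, semigraphoidIdeal_eq]
    exact Ideal.mul_mem_left _ _ (poly_mem_moveIdeal hq)
  · obtain ⟨ha, hb, hM, -⟩ := higher_check h hh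
    obtain ⟨ha', hb', -, -⟩ := markov_check _ hm
    by_cases hd : ∃ c ∈ maskSet h.2.2.1, d c ≠ 0
    · obtain ⟨c, hc, hdc⟩ := hd
      rw [Move.poly, ← binom_add]
      apply monomialProj_binom_mem
      obtain ⟨d', rfl⟩ := exists_add_of_le (Finsupp.single_le_iff.2 (Nat.one_le_iff_ne_zero.2 hdc))
      rw [add_comm _ d', binom_add, ← mul_one (1 : ℚ), ← monomial_mul, mul_assoc]
      exact Ideal.mul_mem_left _ _ (X_mul_higher_mem hh hc)
    · have hnot : ∀ l : List ℕ, (∀ n ∈ l, n < 24) → (∀ n ∈ l, h.2.2.1.testBit n = false) →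
          ¬ InAllPrimes (d + expo l) := by
        intro l hl hl' hall
        obtain ⟨c, hc, hne⟩ := hall _ hM
        have hdc : d c = 0 := by_contra fun hdc => hd ⟨c, hc, hdc⟩
        rw [Finsupp.add_apply, hdc, zero_add] at hne
        obtain ⟨n, hn, hbit⟩ := (expo_hits_maskSet hl).1 ⟨c, hc, hne⟩
        rw [hl' n hn] at hbit
        exact Bool.noConfusion hbit
      rw [Move.poly, ← binom_add, binom, map_sub, monomialProj_monomial, monomialProj_monomial,
        if_neg (hnot _ ha' ha), if_neg (hnot _ hb' hb), sub_zero]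
      exact zero_mem _

theorem semigraphoidIdeal_eq_inf :
    semigraphoidIdeal 4 = toricIdeal 4 ⊓ sInf monomialPrimes := by
  apply le_antisymm
  · refine le_inf ?_ ?_
    · rw [toricIdeal_eq_toricKernel]
      exact semigraphoidIdeal_le_toricKernel
    · rw [monomialPrimes_eq]
      refine le_sInf ?_
      rintro _ ⟨M, hM, rfl⟩
      exact semigraphoidIdeal_le_maskIdeal hM
  · rintro f ⟨hf, hf'⟩
    have hproj : monomialProj InAllPrimes f = f := by
      refine monomialProj_eq_self fun u hu M hM => ?_
      rw [monomialPrimes_eq] at hf'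
      exact mem_varIdeal.1 (Submodule.mem_sInf.1 hf' _ ⟨M, hM, rfl⟩) u hu
    rw [toricIdeal_eq_moveIdeal] at hf
    rw [← hproj]
    refine linearMap_mem_of_mem_span ((semigraphoidIdeal 4).restrictScalars ℚ) _ ?_ hf
    rintro _ ⟨m, hm, rfl⟩ d
    exact monomialProj_markov_mem hm d

theorem expo_ne_of_mem_markov {m : Move} (hm : m ∈ markov) : expo m.1 ≠ expo m.2 := by
  intro h
  obtain ⟨hne, hcop⟩ := markov_coprime m hm
  obtain ⟨n, hn⟩ := List.exists_mem_of_ne_nil _ hne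
  obtain ⟨c, rfl⟩ := exists_idx ((markov_check m hm).1 n hn)
  have h1 := DFunLike.congr_fun h c
  rw [expo_apply, expo_apply, List.count_eq_zero_of_not_mem (hcop _ hn)] at h1
  exact (List.count_pos_iff.2 hn).ne' h1

theorem coeff_poly_fst {m : Move} (hm : m ∈ markov) : coeff (expo m.1) m.poly = 1 := by
  classical
  rw [Move.poly, binom, coeff_sub, coeff_monomial, coeff_monomial, if_pos rfl,
    if_neg (expo_ne_of_mem_markov hm).symm, sub_zero]

theorem toricIdeal_not_le_maskIdeal {M : ℕ} (hM : M ∈ primeMasks) :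
    ¬ toricIdeal 4 ≤ maskIdeal M := by
  intro hle
  obtain ⟨h, hh, rfl⟩ := primeMasks_avoided M hM
  have hm := mem_markov_of_higher hh
  have hmem : Move.poly (h.1, h.2.1) ∈ maskIdeal h.2.2.1 := hle (by
    rw [toricIdeal_eq_moveIdeal]
    exact poly_mem_moveIdeal hm)
  have hc := mem_varIdeal.1 hmem (expo h.1) (mem_support_iff.2 (by
    rw [coeff_poly_fst hm]
    exact one_ne_zero))
  obtain ⟨n, hn, hbit⟩ := (expo_hits_maskSet (markov_check _ hm).1).1 hc
  rw [(higher_check h hh).1 n hn] at hbit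
  exact Bool.noConfusion hbit

theorem maskIdeal_not_le_toricIdeal {M : ℕ} (hM : M ∈ primeMasks) :
    ¬ maskIdeal M ≤ toricIdeal 4 := by
  intro hle
  obtain ⟨n, hn, hbit⟩ := (quads_hit ([1, 6], [0, 8]) (by decide) M hM).1
  obtain ⟨c, rfl⟩ := exists_idx (n := n) (by
    simp only [List.mem_cons, List.not_mem_nil, or_false] at hn
    omega)
  exact X_notMem_toricIdeal c (hle (X_mem_varIdeal.2 hbit))

theorem toricIdeal_notMem : toricIdeal 4 ∉ monomialPrimes := by
  rw [monomialPrimes_eq]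
  rintro ⟨M, hM, h⟩
  exact toricIdeal_not_le_maskIdeal hM h.ge

theorem semigraphoidIdeal_eq_sInf :
    semigraphoidIdeal 4 = sInf (insert (toricIdeal 4) monomialPrimes) := by
  rw [sInf_insert, ← semigraphoidIdeal_eq_inf]

theorem isPrime_of_mem {P : Ideal (Poly 4)} (hP : P ∈ insert (toricIdeal 4) monomialPrimes) :
    P.IsPrime := by
  rw [monomialPrimes_eq] at hP
  rcases hP with rfl | ⟨M, -, rfl⟩
  · infer_instance
  · infer_instance

theorem isRadical_semigraphoidIdeal : (semigraphoidIdeal 4).IsRadical := by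
  rw [semigraphoidIdeal_eq_sInf]
  rintro f ⟨n, hn⟩
  rw [Submodule.mem_sInf] at hn ⊢
  exact fun P hP => (isPrime_of_mem hP).mem_of_pow_mem n (hn P hP)

theorem associatedPrimes_semigraphoidIdeal :
    associatedPrimes (Poly 4) (Poly 4 ⧸ semigraphoidIdeal 4) =
      insert (toricIdeal 4) monomialPrimes := by
  rw [semigraphoidIdeal_eq_sInf]
  refine associatedPrimes_quotient_sInf ?_ (fun P hP => isPrime_of_mem hP) ?_
  · rw [monomialPrimes_eq]
    exact ((List.finite_toSet primeMasks).image _).insert _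
  · rw [monomialPrimes_eq]
    rintro _ (rfl | ⟨M, hM, rfl⟩) _ (rfl | ⟨N, hN, rfl⟩) hle
    · rfl
    · exact absurd hle (toricIdeal_not_le_maskIdeal hN)
    · exact absurd hle (maskIdeal_not_le_toricIdeal hM)
    · rcases primeMasks_antichain M hM N hN with rfl | ⟨n, hn, h1, h2⟩
      · rfl
      · have := testBit_eq_of_maskSet_subset (varIdeal_le.1 hle) (List.mem_range.1 hn) h1
        rw [h2] at this
        exact Bool.noConfusion this

/-! ### Uniqueness of the Markov basis up to signs -/

theorem removeOne_ne_none {l : List ℕ} {n : ℕ} (h : n ∈ l) : removeOne l n ≠ none := by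
  induction l with
  | nil => simp at h
  | cons x xs ih =>
    rw [removeOne]
    split_ifs with hx
    · simp
    · rw [Ne, Option.map_eq_none_iff]
      refine ih ((List.mem_cons.1 h).resolve_left fun h' => hx ?_)
      rw [h', beq_self_eq_true]

theorem not_expo_le_of_removeAll {l a : List ℕ} (ha : ∀ n ∈ a, n < 24)
    (h : removeAll l a = none) : ¬ expo a ≤ expo l := by
  induction a generalizing l with
  | nil => simp [removeAll] at h
  | cons n ns ih =>
    intro hle
    obtain ⟨c, rfl⟩ := exists_idx (ha n (by simp))
    have hmem : idx c ∈ l := by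
      have := hle c
      rw [expo_apply, expo_apply, List.count_cons_self] at this
      exact List.count_pos_iff.1 (by omega)
    obtain ⟨l', hl'⟩ := Option.ne_none_iff_exists'.1 (removeOne_ne_none hmem)
    rw [removeAll, hl', Option.bind_some] at h
    refine ih (fun m hm => ha m (by simp [hm])) h ?_
    rw [expo_removeOne hl', expo_cons] at hle
    exact le_of_add_le_add_left hle

theorem not_expo_le_of_ne {m m' : Move} (hm : m ∈ markov) (hm' : m' ∈ markov) (h : m ≠ m') :
    (¬ expo m'.1 ≤ expo m.1 ∧ ¬ expo m'.2 ≤ expo m.1) ∧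
      ¬ expo m'.1 ≤ expo m.2 ∧ ¬ expo m'.2 ≤ expo m.2 := by
  obtain ⟨h1, h2, -, -⟩ := markov_check m' hm'
  obtain ⟨h3, h4, h5, h6⟩ := (markov_indispensable m hm m' hm').resolve_left h
  exact ⟨⟨not_expo_le_of_removeAll h1 h3, not_expo_le_of_removeAll h2 h4⟩,
    not_expo_le_of_removeAll h1 h5, not_expo_le_of_removeAll h2 h6⟩

theorem degree_expo_eq {m : Move} (hm : m ∈ markov) : (expo m.1).degree = (expo m.2).degree := by
  obtain ⟨h1, h2, h3, -⟩ := markov_check m hm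
  rw [degree_expo h1, degree_expo h2, h3]

theorem eq_zero_of_add_eq {m : Move} (hm : m ∈ markov) {d : CI 4 →₀ ℕ} :
    (d + expo m.1 = expo m.2 → False) ∧ (d + expo m.2 = expo m.1 → False) := by
  have hdeg := degree_expo_eq hm
  have key : ∀ u v : CI 4 →₀ ℕ, u.degree = v.degree → u ≠ v → d + u = v → False := by
    intro u v huv hne h
    have h1 := congrArg Finsupp.degree h
    rw [map_add] at h1
    have h2 : d = 0 := (Finsupp.degree_eq_zero_iff d).1 (by omega)
    rw [h2, zero_add] at h
    exact hne h
  exact ⟨key _ _ hdeg (expo_ne_of_mem_markov hm), key _ _ hdeg.symm (expo_ne_of_mem_markov hm).symm⟩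

/-- The sum of the coefficients at the two monomials of `m` vanishes on the toric ideal: on `m`
itself they cancel, proper multiples of `m` miss both monomials for degree reasons, and multiples of
other Markov binomials miss them by non-divisibility. -/
theorem eq_or_eq_of_binom_mem {m : Move} (hm : m ∈ markov) {u : CI 4 →₀ ℕ}
    (h : binom (expo m.1) u ∈ toricIdeal 4) : u = expo m.1 ∨ u = expo m.2 := by
  classical
  let φ : Poly 4 →ₗ[ℚ] ℚ := lcoeff ℚ (expo m.1) + lcoeff ℚ (expo m.2)
  have hφ : ∀ t, φ (monomial t 1) =
      (if t = expo m.1 then 1 else 0) + if t = expo m.2 then 1 else 0 := fun t => by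
    simp [φ, coeff_monomial]
  have hzero : φ (binom (expo m.1) u) ∈ (⊥ : Submodule ℚ ℚ) := by
    rw [toricIdeal_eq_moveIdeal] at h
    refine linearMap_mem_of_mem_span ⊥ φ ?_ h
    rintro _ ⟨m', hm', rfl⟩ d
    rw [Submodule.mem_bot, Move.poly, ← binom_add, binom, map_sub, hφ, hφ]
    by_cases hmm : m = m'
    · subst hmm
      have h1 := (eq_zero_of_add_eq hm (d := d)).1
      have h2 := (eq_zero_of_add_eq hm (d := d)).2
      have h3 : d + expo m.1 = expo m.1 ↔ d = 0 := by simp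
      have h4 : d + expo m.2 = expo m.2 ↔ d = 0 := by simp
      rw [if_neg h1, if_neg h2, if_congr h3 rfl rfl, if_congr h4 rfl rfl, add_zero, zero_add,
        sub_self]
    · obtain ⟨⟨h1, h2⟩, h3, h4⟩ := not_expo_le_of_ne hm hm' hmm
      rw [if_neg fun h => h1 (le_add_self.trans_eq h), if_neg fun h => h3 (le_add_self.trans_eq h),
        if_neg fun h => h2 (le_add_self.trans_eq h), if_neg fun h => h4 (le_add_self.trans_eq h)]
      simp
  rw [Submodule.mem_bot, binom, map_sub, hφ, hφ, if_pos rfl,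
    if_neg (expo_ne_of_mem_markov hm)] at hzero
  by_contra hne
  rw [not_or] at hne
  rw [if_neg hne.1, if_neg hne.2] at hzero
  norm_num at hzero

theorem eq_zero_of_le_of_le {m : Move} (hm : m ∈ markov) {d : CI 4 →₀ ℕ} (h1 : d ≤ expo m.1)
    (h2 : d ≤ expo m.2) : d = 0 := by
  ext c
  by_contra hne
  have h3 := h1 c
  have h4 := h2 c
  rw [Finsupp.coe_zero, Pi.zero_apply] at hne
  rw [expo_apply] at h3 h4
  have h5 : 0 < d c := Nat.pos_of_ne_zero hne
  exact (markov_coprime m hm).2 _ (List.count_pos_iff.1 (h5.trans_le h3))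
    (List.count_pos_iff.1 (h5.trans_le h4))

/-- Some monomial multiple of a member of `H` must involve the first monomial of `m`. Its other
monomial can only be the second one of `m`, and as these two are coprime, the multiplier is 1. -/
theorem poly_mem_of_span_eq {H : Set (Poly 4)} (hH : ∀ g ∈ H, IsBinomial g)
    (hspan : Ideal.span H = toricIdeal 4) {m : Move} (hm : m ∈ markov) :
    m.poly ∈ H ∨ -m.poly ∈ H := by
  classical
  obtain ⟨g, hg, d, hne⟩ : ∃ g ∈ H, ∃ d, coeff (expo m.1) (monomial d 1 * g) ≠ 0 := by
    by_contra hcon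
    push Not at hcon
    have hmem : m.poly ∈ Ideal.span H := by
      rw [hspan, toricIdeal_eq_moveIdeal]
      exact poly_mem_moveIdeal hm
    have := linearMap_mem_of_mem_span ⊥ (lcoeff ℚ (expo m.1)) (fun g hg d => hcon g hg d) hmem
    rw [Submodule.mem_bot, lcoeff_apply, coeff_poly_fst hm] at this
    exact one_ne_zero this
  obtain ⟨u, v, rfl⟩ := hH g hg
  change coeff (expo m.1) (monomial d 1 * binom u v) ≠ 0 at hne
  have hmem : binom (d + u) (d + v) ∈ toricIdeal 4 := by
    rw [binom_add, ← hspan]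
    exact Ideal.mul_mem_left _ _ (Ideal.subset_span hg)
  have key : ∀ {u v : CI 4 →₀ ℕ}, u ≠ v → d + u = expo m.1 →
      binom (d + u) (d + v) ∈ toricIdeal 4 → u = expo m.1 ∧ v = expo m.2 := by
    intro u v huv hu hmem
    rw [hu] at hmem
    rcases eq_or_eq_of_binom_mem hm hmem with hv | hv
    · exact absurd (add_left_cancel (hu.trans hv.symm)) huv
    · have hd : d = 0 := eq_zero_of_le_of_le hm (hu ▸ le_self_add) (hv ▸ le_self_add)
      rw [hd, zero_add] at hu hv
      exact ⟨hu, hv⟩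
  have huv : u ≠ v := by
    rintro rfl
    simp [binom] at hne
  rw [← binom_add, binom, coeff_sub, coeff_monomial, coeff_monomial] at hne
  by_cases hu : d + u = expo m.1
  · obtain ⟨rfl, rfl⟩ := key huv hu hmem
    exact Or.inl hg
  · by_cases hv : d + v = expo m.1
    · rw [binom_symm, neg_mem_iff] at hmem
      obtain ⟨rfl, rfl⟩ := key huv.symm hv hmem
      right
      rw [Move.poly, ← binom_symm]
      exact hg
    · simp [hu, hv] at hne

theorem eq_of_poly_eq {m m' : Move} (hm : m ∈ markov) (hm' : m' ∈ markov)
    (h : m.poly = m'.poly ∨ m.poly = -m'.poly) : m = m' := by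
  classical
  by_contra hne
  obtain ⟨⟨h1, h2⟩, -⟩ := not_expo_le_of_ne hm hm' hne
  have h0 : coeff (expo m.1) m'.poly = 0 := by
    rw [Move.poly, binom, coeff_sub, coeff_monomial, coeff_monomial, if_neg fun h => h1 h.le,
      if_neg fun h => h2 h.le, sub_zero]
  have h3 := coeff_poly_fst hm
  rcases h with h | h
  · rw [h, h0] at h3
    exact zero_ne_one h3
  · rw [h, coeff_neg, h0, neg_zero] at h3
    exact zero_ne_one h3

theorem poly_ne_zero {m : Move} (hm : m ∈ markov) : m.poly ≠ 0 := fun h => by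
  have := coeff_poly_fst hm
  rw [h, coeff_zero] at this
  exact zero_ne_one this

theorem totalDegree_poly {m : Move} (hm : m ∈ markov) : m.poly.totalDegree = m.1.length := by
  obtain ⟨h1, h2, h3, -⟩ := markov_check m hm
  refine IsHomogeneous.totalDegree ?_ (poly_ne_zero hm)
  exact IsHomogeneous.sub (isHomogeneous_monomial _ (degree_expo h1))
    (isHomogeneous_monomial _ ((degree_expo h2).trans h3.symm))

theorem exists_isMarkovBasis : ∃ G, IsMarkovBasis (toricIdeal 4) G := by
  refine ⟨{f | ∃ m ∈ markov, f = m.poly}, ?_, ?_, ?_⟩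
  · rintro _ ⟨m, -, rfl⟩
    exact ⟨_, _, rfl⟩
  · rw [toricIdeal_eq_moveIdeal]
    rfl
  · rintro H ⟨hle, hnot⟩ hspan
    apply hnot
    rintro _ ⟨m, hm, rfl⟩
    refine (poly_mem_of_span_eq (fun g hg => ?_) hspan hm).resolve_right fun hneg => ?_
    · obtain ⟨m, -, rfl⟩ := hle hg
      exact ⟨_, _, rfl⟩
    · obtain ⟨m', hm', h⟩ := hle hneg
      obtain rfl := eq_of_poly_eq hm hm' (Or.inr (by rw [← h, neg_neg]))
      exact poly_ne_zero hm (self_eq_neg.1 h.symm)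

/-- One signed copy of each listed binomial lies in `G`. These copies already generate, so by
minimality they are all of `G`. -/
theorem isMarkovBasis_cards {G : Set (Poly 4)} (hG : IsMarkovBasis (toricIdeal 4) G) :
    G.encard = 49 ∧ ∀ k, {g ∈ G | g.totalDegree = k}.encard =
      (markov.countP fun m => m.1.length == k) := by
  classical
  obtain ⟨hbin, hspan, hmin⟩ := hG
  -- The choice is made for all moves, with the irrelevant value 0 outside `markov`.
  have hs : ∀ m : Move, ∃ g : Poly 4, m ∈ markov → g ∈ G ∧ (g = m.poly ∨ g = -m.poly) := by
    intro m
    by_cases hm : m ∈ markov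
    · rcases poly_mem_of_span_eq hbin hspan hm with h | h
      · exact ⟨_, fun _ => ⟨h, Or.inl rfl⟩⟩
      · exact ⟨_, fun _ => ⟨h, Or.inr rfl⟩⟩
    · exact ⟨0, fun h => absurd h hm⟩
  choose s hs using hs
  have hsub : s '' {m | m ∈ markov} ⊆ G := by
    rintro _ ⟨m, hm, rfl⟩
    exact (hs m hm).1
  have hspan' : Ideal.span (s '' {m | m ∈ markov}) = toricIdeal 4 := by
    apply le_antisymm
    · rw [← hspan]
      exact Ideal.span_mono hsub
    · rw [toricIdeal_eq_moveIdeal]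
      refine moveIdeal_le fun m hm => ?_
      have hmem : s m ∈ Ideal.span (s '' {m | m ∈ markov}) := Ideal.subset_span ⟨m, hm, rfl⟩
      rcases (hs m hm).2 with h | h
      · rwa [h] at hmem
      · rwa [h, neg_mem_iff] at hmem
  have hG : s '' {m | m ∈ markov} = G := by
    by_contra hne
    exact hmin _ (hsub.ssubset_of_ne hne) hspan'
  have hinj : Set.InjOn s {m | m ∈ markov} := by
    intro m hm m' hm' h
    apply eq_of_poly_eq hm hm'
    rcases (hs m hm).2 with h1 | h1 <;> rcases (hs m' hm').2 with h2 | h2 <;>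
      rw [h1, h2] at h
    · exact Or.inl h
    · exact Or.inr h
    · exact Or.inr (neg_eq_iff_eq_neg.1 h)
    · exact Or.inl (neg_inj.1 h)
  have hcard : ∀ p : Move → Bool, (s '' {m | m ∈ markov ∧ p m = true}).encard =
      markov.countP p := by
    intro p
    rw [(hinj.mono fun m hm => hm.1).encard_image, List.countP_eq_length_filter,
      ← List.toFinset_card_of_nodup (markov_nodup.filter _), ← Set.encard_coe_eq_coe_finsetCard]
    congr 1
    ext m
    simp
  constructor
  · have := hcard fun _ => true
    rw [List.countP_true, markov_lengths.1] at this
    simpa [hG] using this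
  · intro k
    rw [← hcard]
    congr 1
    rw [← hG]
    have hdeg : ∀ m ∈ markov, (s m).totalDegree = m.1.length := fun m hm => by
      rcases (hs m hm).2 with h | h
      · rw [h, totalDegree_poly hm]
      · rw [h, totalDegree_neg, totalDegree_poly hm]
    ext g
    constructor
    · rintro ⟨⟨m, hm, rfl⟩, hk⟩
      rw [hdeg m hm] at hk
      exact ⟨m, ⟨hm, beq_iff_eq.2 hk⟩, rfl⟩
    · rintro ⟨m, ⟨hm, hk⟩, rfl⟩
      exact ⟨⟨m, hm, rfl⟩, (hdeg m hm).trans (beq_iff_eq.1 hk)⟩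

end Semigraphoid

end

theorem proposition5p1 :
    -- there are 24 unknowns
    Fintype.card (Semigraphoid.CI 4) = 24 ∧
    -- the semigraphoid ideal is radical, and it is the stated intersection
    (Semigraphoid.semigraphoidIdeal 4).IsRadical ∧
    Semigraphoid.semigraphoidIdeal 4 =
      Semigraphoid.toricIdeal 4 ⊓ sInf Semigraphoid.monomialPrimes ∧
    -- the associated primes are the toric ideal and 17 further primes
    associatedPrimes (Semigraphoid.Poly 4)
        (Semigraphoid.Poly 4 ⧸ Semigraphoid.semigraphoidIdeal 4) =
      insert (Semigraphoid.toricIdeal 4) Semigraphoid.monomialPrimes ∧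
    Semigraphoid.toricIdeal 4 ∉ Semigraphoid.monomialPrimes ∧
    Semigraphoid.monomialPrimes.ncard = 17 ∧
    -- the classes of monomial primes
    Semigraphoid.primes12.ncard = 2 ∧
    (∀ P ∈ Semigraphoid.primes12, P.height = 12) ∧
    Semigraphoid.primes15.ncard = 12 ∧
    (∀ P ∈ Semigraphoid.primes15, P.height = 15) ∧
    Semigraphoid.primes16.ncard = 3 ∧
    (∀ P ∈ Semigraphoid.primes16, P.height = 16) ∧
    -- the toric ideal: codimension, degree, minimal generators
    (Semigraphoid.toricIdeal 4).height = 13 ∧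
    Semigraphoid.HasDegree (Semigraphoid.toricIdeal 4) 396 ∧
    (∃ G, Semigraphoid.IsMarkovBasis (Semigraphoid.toricIdeal 4) G) ∧
    (∀ G, Semigraphoid.IsMarkovBasis (Semigraphoid.toricIdeal 4) G →
      G.encard = 49 ∧
      {g ∈ G | g.totalDegree = 2}.encard = 24 ∧
      {g ∈ G | g.totalDegree = 3}.encard = 4 ∧
      {g ∈ G | g.totalDegree = 4}.encard = 21) := by
  have h15 : Semigraphoid.primes15.ncard = 12 := by
    rw [Semigraphoid.primes15_eq, Semigraphoid.ncard_maskIdeals (by decide) (by decide)]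
    rfl
  have h16 : Semigraphoid.primes16.ncard = 3 := by
    rw [Semigraphoid.primes16_eq, Semigraphoid.ncard_maskIdeals (by decide) (by decide)]
    rfl
  have h12 : Semigraphoid.primes12.ncard = 2 := by
    rw [Semigraphoid.primes12_eq, Semigraphoid.ncard_maskIdeals (by decide) (by decide)]
    rfl
  have h17 : Semigraphoid.monomialPrimes.ncard = 17 := by
    rw [Semigraphoid.monomialPrimes_eq,
      Semigraphoid.ncard_maskIdeals Semigraphoid.masks_check.1 Semigraphoid.masks_check.2.1]
    rfl
  obtain ⟨-, -, hc12, hc15, hc16⟩ := Semigraphoid.masks_check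
  refine ⟨Semigraphoid.card_CI_four, Semigraphoid.isRadical_semigraphoidIdeal,
    Semigraphoid.semigraphoidIdeal_eq_inf, Semigraphoid.associatedPrimes_semigraphoidIdeal,
    Semigraphoid.toricIdeal_notMem, h17, h12, ?_, h15, ?_, h16, ?_,
    Semigraphoid.height_toricIdeal, Semigraphoid.hasDegree_toricIdeal,
    Semigraphoid.exists_isMarkovBasis, fun G hG => ?_⟩
  · rw [Semigraphoid.primes12_eq]
    exact Semigraphoid.height_of_mem_maskIdeals hc12
  · rw [Semigraphoid.primes15_eq]
    exact Semigraphoid.height_of_mem_maskIdeals hc15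
  · rw [Semigraphoid.primes16_eq]
    exact Semigraphoid.height_of_mem_maskIdeals hc16
  · obtain ⟨h, hk⟩ := Semigraphoid.isMarkovBasis_cards hG
    obtain ⟨-, h2, h3, h4⟩ := Semigraphoid.markov_lengths
    refine ⟨h, ?_, ?_, ?_⟩
    · rw [hk, h2]
      rfl
    · rw [hk, h3]
      rfl
    · rw [hk, h4]
      rfl
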